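/- Let $K$ be a totally real field, i.e. a (possibly infinite) algebraic extension of $\mathbb{Q}$ such that every embedding $K\hookrightarrow\mathbb{C}$ has image in $\mathbb{R}$. Fix an embedding $K\hookrightarrow\mathbb{R}$, order $K$ by it, let $\mathcal{O}$ be the ring of algebraic integers in $K$, and put $\mathcal{O}_{\ge 1}=\{a\in\mathcal{O}\mid a\ge 1\}$. Let $V$ be a nonzero finite-dimensional $K$-vector space with a symmetric $K$-bilinear form $(x,y)\mapsto x\cdot y\in K$ that is totally positive definite: $\sigma(x\cdot x)>0$ for every real embedding $\sigma$ of $K$ and every $x\in V\setminus\{0\}$. An $\mathcal{O}$-lattice in a subspace $W\subseteq V$ is an $\mathcal{O}$-submodule $\mathcal{O}v_1+\dots+\mathcal{O}v_n$ with $v_1,\dots,v_n$ a $K$-basis of $W$. Let $L$ be a root lattice in $V$: an $\mathcal{O}$-lattice in $V$ such that $x\cdot y\in\mathcal{O}$ for all $x,y\in L$ and such that $L$ is generated as an $\mathcal{O}$-module by the set of roots $\Phi(L)=\{x\in L\mid x\cdot x=2\}$. Suppose that $\Phi(L)$ is finite and that $L$ is irreducible, i.e. there is no orthogonal decomposition $V=V_1\oplus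 V_2$ with $V_1,V_2\ne 0$ and $L=L_1\oplus L_2$ for $\mathcal{O}$-lattices $L_i$ in $V_i$. A fundamental system of roots of $L$ is a subset $\Delta\subseteq\Phi(L)$ that is a $K$-basis of $V$ and such that every $\alpha\in\Phi(L)$ can be written as $\alpha=\sum_{\beta\in\Delta}c_\beta\beta$ with either $c_\beta\in\mathcal{O}_{\ge 1}\cup\{0\}$ for all $\beta\in\Delta$, or $-c_\beta\in\mathcal{O}_{\ge 1}\cup\{0\}$ for all $\beta\in\Delta$. Then $L$ has a fundamental system of roots. Moreover, for every fundamental system of roots $\Delta$ of $L$ and all $\alpha,\beta\in\Delta$ there is a unique positive integer $m(\alpha,\beta)$ with $\alpha\cdot\beta=-2\cos(\pi/m(\alpha,\beta))$; here $m(\alpha,\beta)=m(\beta,\alpha)$, and $m(\alpha,\beta)=1$ if and only if $\alpha=\beta$. The Coxeter–Dynkin diagram of $L$ with respect to $\Delta$, that is, the graph with vertex set $\Delta$ in which distinct $\alpha,\beta$ are joined by an edge if and only if $m(\alpha,\beta)\ge 3$, this edge being labelled with $m(\alpha,\beta)$ if $m(\alpha,\beta)\ge 4$, is isomorphic as a labelled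 graph to one of the following diagrams of the irreducible finite Coxeter systems (edges are unlabelled unless a label is mentioned): - $A_n$ ($n\ge 1$): the path with $n$ vertices; - $B_n$ ($n\ge 2$): the path with $n$ vertices, with one end edge labelled $4$; - $D_n$ ($n\ge 4$): the path with $n-2$ vertices, with two further vertices, both joined to the same end vertex of the path; - $E_n$ ($n=6,7,8$): the path with $n-1$ vertices, with a further vertex joined to the third vertex of the path; - $F_4$: the path with $4$ vertices, with the middle edge labelled $4$; - $H_n$ ($n=3,4$): the path with $n$ vertices, with one end edge labelled $5$; - $I_2(m)$ ($m\ge 5$): two vertices joined by an edge labelled $m$. -/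

import Mathlib

open NumberField

/-! ### Labelled graphs and Coxeter–Dynkin diagrams -/

/-- A graph on the vertex set `V`, some of whose edges carry a number.
`label i j` is the number written on the edge joining `i` and `j`, and `none` if there is none. -/
structure LabelledGraph (V : Type*) where
  graph : SimpleGraph V
  label : V → V → Option ℕ
  label_symm : ∀ i j, label i j = label j i
  adj_of_label : ∀ i j, label i j ≠ none → graph.Adj i j

namespace LabelledGraph

/-- Two labelled graphs are the same up to a bijection of the vertices
that respects edges and labels. -/
def Iso {V W : Type*} (D : LabelledGraph V) (E : LabelledGraph W) : Prop :=
  ∃ e : V ≃ W, (∀ i j, E.graph.Adj (e i) (e j) ↔ D.graph.Adj i j) ∧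
    ∀ i j, E.label (e i) (e j) = D.label i j

/-- The Coxeter–Dynkin diagram of a Coxeter matrix `m`: two vertices are joined if and only if
`m i j ≥ 3`, and the edge is labelled with `m i j` if `m i j ≥ 4`.
(In a `CoxeterMatrix` the entry `0` encodes `∞`.) -/
def ofCoxeterMatrix {V : Type*} (M : CoxeterMatrix V) : LabelledGraph V where
  graph :=
    { Adj := fun i j => 3 ≤ M i j ∨ M i j = 0
      symm := ⟨fun i j h => by rwa [M.symmetric j i]⟩
      loopless := ⟨fun i h => by simp at h⟩ }
  label i j := if 4 ≤ M i j ∨ M i j = 0 then some (M i j) else none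
  label_symm i j := by rw [M.symmetric i j]
  adj_of_label i j h := by
    by_contra hc
    apply h
    rw [if_neg]
    intro h'
    exact hc (h'.imp (fun h4 => by omega) id)

/-- The path `0 — 1 — ⋯ — n-1` on `n` vertices; the edge joining `i` and `i + 1` carries
the label `l i` (no label if `l i = none`). -/
def path (n : ℕ) (l : ℕ → Option ℕ) : LabelledGraph (Fin n) where
  graph :=
    { Adj := fun i j => (i : ℕ) + 1 = j ∨ (j : ℕ) + 1 = i
      symm := ⟨fun _ _ h => h.symm⟩
      loopless := ⟨fun i h => by omega⟩ }
  label i j := if (i : ℕ) + 1 = j then l i else if (j : ℕ) + 1 = i then l j else none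
  label_symm i j := by
    by_cases h1 : (i : ℕ) + 1 = j
    · have h2 : ¬ (j : ℕ) + 1 = i := by omega
      simp [h1, h2]
    · simp [h1]
  adj_of_label i j h := by
    by_contra hc
    apply h
    rw [not_or] at hc
    rw [if_neg hc.1, if_neg hc.2]

/-- The unlabelled graph on `n` vertices consisting of the path `0 — 1 — ⋯ — n-2` and of one more
vertex `n-1`, which is joined to the vertex `k` of the path only. -/
def fork (n k : ℕ) : LabelledGraph (Fin n) where
  graph := SimpleGraph.fromRel fun i j =>
    ((i : ℕ) + 1 = j ∧ (j : ℕ) + 1 < n) ∨ ((i : ℕ) = k ∧ (j : ℕ) + 1 = n)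
  label _ _ := none
  label_symm _ _ := rfl
  adj_of_label _ _ h := absurd rfl h

/-- `Aₙ`: a path with `n` vertices and no labels. -/
def typeA (n : ℕ) : LabelledGraph (Fin n) := path n fun _ => none

/-- `Bₙ`: a path with `n` vertices whose last edge is labelled `4`. -/
def typeB (n : ℕ) : LabelledGraph (Fin n) := path n fun i => if i + 2 = n then some 4 else none

/-- `Dₙ`: the path `0 — ⋯ — n-3`, whose end `n-3` is joined to two further vertices
`n-2` and `n-1`. -/
def typeD (n : ℕ) : LabelledGraph (Fin n) := fork n (n - 3)

/-- `Eₙ`: a path with `n-1` vertices and a further vertex joined to its third vertex. -/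
def typeE (n : ℕ) : LabelledGraph (Fin n) := fork n 2

/-- `F₄`: a path with `4` vertices whose middle edge is labelled `4`. -/
def typeF₄ : LabelledGraph (Fin 4) := path 4 fun i => if i = 1 then some 4 else none

/-- `Hₙ`: a path with `n` vertices whose first edge is labelled `5`. -/
def typeH (n : ℕ) : LabelledGraph (Fin n) := path n fun i => if i = 0 then some 5 else none

/-- `I₂(m)`: a single edge labelled `m`. -/
def typeI₂ (m : ℕ) : LabelledGraph (Fin 2) := path 2 fun _ => some m

/-- `D` is one of the diagrams of the irreducible finite Coxeter systems: `Aₙ` (`n ≥ 1`),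
`Bₙ` (`n ≥ 2`), `Dₙ` (`n ≥ 4`), `E₆`, `E₇`, `E₈`, `F₄`, `H₃`, `H₄`, `I₂(m)` (`m ≥ 5`). -/
def IsIrreducibleFiniteType {V : Type*} (D : LabelledGraph V) : Prop :=
  (∃ n, 1 ≤ n ∧ D.Iso (typeA n)) ∨
  (∃ n, 2 ≤ n ∧ D.Iso (typeB n)) ∨
  (∃ n, 4 ≤ n ∧ D.Iso (typeD n)) ∨
  D.Iso (typeE 6) ∨ D.Iso (typeE 7) ∨ D.Iso (typeE 8) ∨
  D.Iso typeF₄ ∨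
  D.Iso (typeH 3) ∨ D.Iso (typeH 4) ∨
  (∃ m, 5 ≤ m ∧ D.Iso (typeI₂ m))

end LabelledGraph

/-! ### Root lattices over the ring of integers of a totally real field -/

namespace RootLattice

section

variable {K : Type*} [Field K] {V : Type*} [AddCommGroup V] [Module K V]

/-- `σ(x · x) > 0` for every real embedding `σ` and every `x ≠ 0`. -/
def IsTotallyPosDef (B : LinearMap.BilinForm K V) : Prop :=
  ∀ σ : K →+* ℝ, ∀ x : V, x ≠ 0 → 0 < σ (B x x)

variable [Module (𝓞 K) V]

/-- `L` is an `𝓞`-lattice in the subspace `W` of `V`: there is a `K`-basis `v₁, …, vₙ` of `W`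
such that `L = 𝓞 v₁ + ⋯ + 𝓞 vₙ`. -/
def IsLatticeIn (W : Submodule K V) (L : Submodule (𝓞 K) V) : Prop :=
  ∃ (n : ℕ) (v : Fin n → V), LinearIndependent K v ∧
    Submodule.span K (Set.range v) = W ∧ Submodule.span (𝓞 K) (Set.range v) = L

/-- `L` is reducible: there are an orthogonal decomposition `V = V₁ ⊕ V₂` with `V₁, V₂ ≠ 0` and
`𝓞`-lattices `Lᵢ` in `Vᵢ` such that `L = L₁ ⊕ L₂`.
(The sum `L₁ + L₂` is direct because `V₁ ∩ V₂ = 0`.) -/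
def IsReducible (B : LinearMap.BilinForm K V) (L : Submodule (𝓞 K) V) : Prop :=
  ∃ V₁ V₂ : Submodule K V, V₁ ≠ ⊥ ∧ V₂ ≠ ⊥ ∧ IsCompl V₁ V₂ ∧
    (∀ x ∈ V₁, ∀ y ∈ V₂, B x y = 0) ∧
    ∃ L₁ L₂ : Submodule (𝓞 K) V, IsLatticeIn V₁ L₁ ∧ IsLatticeIn V₂ L₂ ∧ L = L₁ ⊔ L₂

/-- The set of roots `Φ(L) = {x ∈ L | x · x = 2}`. -/
def roots (B : LinearMap.BilinForm K V) (L : Submodule (𝓞 K) V) : Set V :=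
  {x | x ∈ L ∧ B x x = 2}

/-- A root lattice in `V`: an integral `𝓞`-lattice in `V` generated by its roots. -/
structure IsRootLattice (B : LinearMap.BilinForm K V) (L : Submodule (𝓞 K) V) : Prop where
  lattice : IsLatticeIn (⊤ : Submodule K V) L
  integral : ∀ x ∈ L, ∀ y ∈ L, ∃ a : 𝓞 K, (a : K) = B x y
  generated : Submodule.span (𝓞 K) (roots B L) = L

/-- A fundamental system of roots of `L`, with respect to the order on `K` that is induced by the
embedding `ι : K → ℝ`. -/
structure IsFundamentalSystem (ι : K →+* ℝ) (B : LinearMap.BilinForm K V)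
    (L : Submodule (𝓞 K) V) (Δ : Set V) : Prop where
  subset_roots : Δ ⊆ roots B L
  linearIndependent : LinearIndependent K ((↑) : Δ → V)
  span_eq_top : Submodule.span K Δ = ⊤
  decomp : ∀ α ∈ roots B L, ∃ c : Δ →₀ 𝓞 K,
    α = c.sum (fun β a => a • (β : V)) ∧
    ((∀ β, c β = 0 ∨ 1 ≤ ι (c β : K)) ∨ (∀ β, c β = 0 ∨ 1 ≤ ι (-(c β) : K)))

/-- `m` is a positive integer with `x · y = -2 cos(π / m)`. -/
def IsCoxeterLabel (ι : K →+* ℝ) (B : LinearMap.BilinForm K V) (x y : V) (m : ℕ) : Prop :=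
  0 < m ∧ ι (B x y) = -2 * Real.cos (Real.pi / m)

end

end RootLattice

/-! Ordering `K` through `ι` makes the form positive definite over an ordered field, and integrality
makes the finite set of roots stable under its reflections. A functional vanishing on no root
selects positive roots. A minimal generating set of their cone has no acute angles, hence is
linearly independent: a simple basis (`exists_isSimpleBasis`).

For two simple roots at angle `π - θ`, alternating reflections give roots with coordinates `sin (kθ)
/ sin θ`; the common sign of the coordinates forces `θ = π / m` (`exists_label`). Distinct simple
roots thus have product `0` or at most `-1`, and descent on the sum of coordinates shows that each
coordinate of a positive root is an integer of `K` that is `0` or at least `1` (`repr_mem`).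

Every fundamental system is such a simple basis and generates `L` over `𝓞 K`, so irreducibility of
`L` makes its diagram connected (`isReducible_of_orthogonal`). The classification then rests on two
tests of positive definiteness: explicit tree weights of nonpositive norm (`pos_of_tree`), and
contraction of a connected set to the centre of a star (`sum_sq_lt_four`). They leave only paths and
forks, with few positions for a label (`IsRealization.isIrreducibleFiniteType`). -/

set_option linter.unusedSectionVars false

/-! ### Existence of simple roots. -/

namespace ReflectionSystem

open Module

variable {F V : Type*} [Field F] [LinearOrder F] [IsStrictOrderedRing F]
  [AddCommGroup V] [Module F V]

/-- A finite set of vectors of norm `2` that is stable under the reflections in its members. -/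
structure IsReflectionStable (B : LinearMap.BilinForm F V) (Φ : Set V) : Prop where
  symm : ∀ x y, B x y = B y x
  pos : ∀ x, x ≠ 0 → 0 < B x x
  finite : Φ.Finite
  norm : ∀ x ∈ Φ, B x x = 2
  reflect : ∀ x ∈ Φ, ∀ y ∈ Φ, y - B x y • x ∈ Φ

/-- A basis consisting of roots such that the coordinates of every root have the same sign. -/
structure IsSimpleBasis {I : Type*} (Φ : Set V) (b : Basis I F V) : Prop where
  mem : ∀ i, b i ∈ Φ
  sign : ∀ γ ∈ Φ, (∀ i, 0 ≤ b.repr γ i) ∨ (∀ i, b.repr γ i ≤ 0)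

variable {B : LinearMap.BilinForm F V} {Φ : Set V}

theorem IsReflectionStable.ne_zero (h : IsReflectionStable B Φ) {x : V} (hx : x ∈ Φ) : x ≠ 0 := by
  rintro rfl
  simpa using h.norm 0 hx

theorem IsReflectionStable.neg_mem (h : IsReflectionStable B Φ) {x : V} (hx : x ∈ Φ) :
    -x ∈ Φ := by
  have := h.reflect x hx x hx
  rw [h.norm x hx, two_smul] at this
  simpa using this

theorem mem_hull_of_smul_mem_hull {S : Set V} {x : V} {f : Dual F V} {t : F} (hx : 0 < f x)
    (ht : t • x ∈ PointedCone.hull F S) (hft : 0 < f (t • x)) : x ∈ PointedCone.hull F S := by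
  rw [map_smul, smul_eq_mul] at hft
  have h0 : 0 < t := pos_of_mul_pos_left hft hx.le
  have := PointedCone.smul_mem (PointedCone.hull F S) (inv_nonneg.2 h0.le) ht
  rwa [inv_smul_smul₀ h0.ne'] at this

theorem nonneg_of_mem_hull {S : Set V} {f : Dual F V} (hS : ∀ x ∈ S, 0 < f x) {x : V}
    (hx : x ∈ PointedCone.hull F S) : 0 ≤ f x := by
  induction hx using Submodule.span_induction with
  | mem x h => exact (hS x h).le
  | zero => simp
  | add x y _ _ hx hy => rw [map_add]; exact add_nonneg hx hy
  | smul a x _ hx =>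
    have : f (a • x) = (a : F) * f x := map_smul f (a : F) x
    rw [this]
    exact mul_nonneg a.2 hx

/-- A redundant generator can be dropped without shrinking the cone. -/
theorem hull_eq_of_mem {S : Set V} {x : V} (hx : x ∈ PointedCone.hull F (S \ {x})) :
    S ⊆ PointedCone.hull F (S \ {x}) := by
  intro y hy
  by_cases hyx : y = x
  · rwa [hyx]
  · exact PointedCone.subset_hull ⟨hy, hyx⟩

theorem exists_eq_smul_add_of_mem_hull {S : Set V} {x y : V} (hx : x ∈ S)
    (hy : y ∈ PointedCone.hull F S) :
    ∃ a : F, ∃ z ∈ PointedCone.hull F (S \ {x}), y = a • x + z := by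
  rw [← Set.insert_sdiff_self_of_mem hx] at hy
  obtain ⟨a, z, hz, rfl⟩ := Submodule.mem_span_insert.1 hy
  exact ⟨a, z, hz, rfl⟩

/-- In a minimal set of generators of the cone of positive roots, the angles are not acute. -/
theorem IsReflectionStable.apply_nonpos (h : IsReflectionStable B Φ) {f : Dual F V}
    (hf : ∀ x ∈ Φ, f x ≠ 0) {S : Set V} (hSΦ : ∀ x ∈ S, x ∈ Φ ∧ 0 < f x)
    (hS : ∀ x ∈ Φ, 0 < f x → x ∈ PointedCone.hull F S)
    (hmin : ∀ x ∈ S, x ∉ PointedCone.hull F (S \ {x}))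
    {x y : V} (hx : x ∈ S) (hy : y ∈ S) (hxy : x ≠ y) : B x y ≤ 0 := by
  by_contra! hc
  -- Expanding such a positive root over `S` and moving its `u`-term to the left puts a multiple of
  -- `u` in the cone of `S \ {u}`. Evaluating `f` shows that the multiple is positive, so `u` is
  -- redundant, against minimality.
  have key : ∀ u ∈ S, ∀ v ∈ S, u ≠ v → ∀ c d : F, 0 < c → 0 < f (d • u - c • v) →
      d • u - c • v ∈ Φ → False := by
    intro u hu v hv huv c d hc hpos hΦ
    obtain ⟨a, z, hz, e⟩ := exists_eq_smul_add_of_mem_hull hu (hS _ hΦ hpos)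
    have e' : (d - a) • u = c • v + z := by
      rw [sub_smul, sub_eq_iff_eq_add.1 e]; abel
    refine hmin u hu (mem_hull_of_smul_mem_hull (t := d - a) (f := f) (hSΦ u hu).2 ?_ ?_)
    · rw [e']
      exact add_mem (PointedCone.smul_mem _ hc.le (PointedCone.subset_hull ⟨hv, huv.symm⟩)) hz
    · rw [e', map_add, map_smul, smul_eq_mul]
      exact add_pos_of_pos_of_nonneg (mul_pos hc (hSΦ v hv).2)
        (nonneg_of_mem_hull (fun w hw => (hSΦ w hw.1).2) hz)
  -- Either this reflected root or its negative is positive; `key` applies with the roles of `x` and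
  -- `y` chosen accordingly.
  have hr := h.reflect x (hSΦ x hx).1 y (hSΦ y hy).1
  rcases lt_or_gt_of_ne (hf _ hr) with hlt | hgt
  · have hr' := h.neg_mem hr
    rw [neg_sub] at hr'
    refine key x hx y hy hxy 1 (B x y) one_pos ?_ (by rwa [one_smul])
    rw [one_smul, ← neg_sub, map_neg]
    linarith
  · exact key y hy x hx hxy.symm (B x y) 1 hc (by rwa [one_smul]) (by rwa [one_smul])

theorem IsReflectionStable.exists_isSimpleBasis (h : IsReflectionStable B Φ)
    (hspan : Submodule.span F Φ = ⊤) :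
    ∃ (Δ : Set V) (b : Basis Δ F V), (∀ i, b i = i) ∧ IsSimpleBasis Φ b := by
  have : Finite Φ := h.finite
  obtain ⟨f, hf⟩ := Module.exists_dual_forall_apply_ne_zero (K := F) (fun x : Φ => (x : V))
    fun x => h.ne_zero x.2
  replace hf : ∀ x ∈ Φ, f x ≠ 0 := fun x hx => hf ⟨x, hx⟩
  set P : Set V := {x | x ∈ Φ ∧ 0 < f x}
  have hP : P.Finite := h.finite.subset fun x hx => hx.1
  obtain ⟨S, hS⟩ := Set.Finite.exists_minimal
    (s := {T : Set V | T ⊆ P ∧ P ⊆ PointedCone.hull F T})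
    (hP.finite_subsets.subset fun T hT => hT.1) ⟨P, subset_rfl, PointedCone.subset_hull⟩
  have hSP : S ⊆ P := hS.prop.1
  have hmin : ∀ x ∈ S, x ∉ PointedCone.hull F (S \ {x}) := by
    intro x hx hxS
    have hle : PointedCone.hull F S ≤ PointedCone.hull F (S \ {x}) :=
      Submodule.span_le.2 (hull_eq_of_mem hxS)
    have := hS.le_of_le (y := S \ {x}) ⟨Set.sdiff_subset.trans hSP, hS.prop.2.trans hle⟩
      Set.sdiff_subset hx
    exact this.2 rfl
  have hobt : ∀ x ∈ S, ∀ y ∈ S, x ≠ y → B x y ≤ 0 := fun x hx y hy hxy =>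
    h.apply_nonpos hf hSP (fun x hx h0 => hS.prop.2 ⟨hx, h0⟩) hmin hx hy hxy
  -- Vectors in an open half-space with pairwise nonpositive products are linearly independent.
  have hli : LinearIndependent F ((↑) : S → V) := by
    refine LinearMap.BilinForm.linearIndependent_of_pairwise_le_zero B ?_ f _
      (fun i => (hSP i.2).2) fun i j hij => hobt _ i.2 _ j.2 (Subtype.coe_ne_coe.2 hij)
    intro x hx
    simpa using h.pos x hx
  have hgen : ∀ x ∈ Φ, x ∈ PointedCone.hull F S ∨ -x ∈ PointedCone.hull F S := by
    intro x hx
    rcases lt_or_gt_of_ne (hf x hx) with hlt | hgt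
    · exact Or.inr (hS.prop.2 ⟨h.neg_mem hx, by rw [map_neg]; linarith⟩)
    · exact Or.inl (hS.prop.2 ⟨hx, hgt⟩)
  have htop : ⊤ ≤ Submodule.span F (Set.range ((↑) : S → V)) := by
    rw [Subtype.range_coe, ← hspan, Submodule.span_le]
    intro x hx
    rcases hgen x hx with h1 | h1
    · exact PointedCone.hull_le_span (R := F) S h1
    · exact (Submodule.neg_mem_iff _).1 (PointedCone.hull_le_span (R := F) S h1)
  set b := Basis.mk hli htop
  have hb : ∀ i, b i = i := fun i => by simp [b]
  have hcone : ∀ x ∈ PointedCone.hull F S, ∀ i, 0 ≤ b.repr x i := by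
    intro x hx i
    induction hx using Submodule.span_induction with
    | mem x hx =>
      have : x = b ⟨x, hx⟩ := (hb ⟨x, hx⟩).symm
      rw [this, Basis.repr_self]
      classical
      rw [Finsupp.single_apply]
      split_ifs <;> norm_num
    | zero => simp
    | add x y _ _ hx hy => rw [map_add]; exact add_nonneg hx hy
    | smul a x _ hx =>
      have : b.repr (a • x) = (a : F) • b.repr x := map_smul b.repr (a : F) x
      rw [this]
      exact mul_nonneg a.2 hx
  refine ⟨S, b, hb, fun i => (hb i).symm ▸ (hSP i.2).1, fun x hx => ?_⟩
  rcases hgen x hx with h1 | h1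
  · exact Or.inl (hcone x h1)
  · refine Or.inr fun i => ?_
    have := hcone _ h1 i
    rw [map_neg, Finsupp.neg_apply] at this
    linarith

end ReflectionSystem

/-! ### Angles between simple roots and coordinates of roots. -/

namespace ReflectionSystem

open Module

variable {F V : Type*} [Field F] [LinearOrder F] [IsStrictOrderedRing F]
  [AddCommGroup V] [Module F V] {B : LinearMap.BilinForm F V} {Φ : Set V}
  {I : Type*} {b : Basis I F V}

/-- The reflection of `b j` in `b i` has coordinate `1` at `j`, so its coordinate `-B (b i) (b j)`
at `i` cannot be negative. -/
theorem IsSimpleBasis.apply_nonpos (h : IsReflectionStable B Φ) (hb : IsSimpleBasis Φ b) {i j : I}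
    (hij : i ≠ j) : B (b i) (b j) ≤ 0 := by
  have key := hb.sign _ (h.reflect _ (hb.mem i) _ (hb.mem j))
  simp only [map_sub, map_smul, Basis.repr_self, Finsupp.sub_apply, Finsupp.smul_apply,
    smul_eq_mul] at key
  rcases key with key | key
  · simpa [hij] using key i
  · have := key j
    simp [hij] at this
    exact absurd this (by norm_num)

theorem IsSimpleBasis.neg_two_lt_apply (h : IsReflectionStable B Φ) (hb : IsSimpleBasis Φ b)
    {i j : I} (hij : i ≠ j) : -2 < B (b i) (b j) := by
  have hne : b i + b j ≠ 0 := by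
    intro h0
    have := congrArg (fun x => b.repr x i) h0
    simp [hij] at this
  have := h.pos _ hne
  simp only [map_add, LinearMap.add_apply, h.norm _ (hb.mem i), h.norm _ (hb.mem j),
    h.symm (b j) (b i)] at this
  linarith

/-- The roots obtained from two simple roots by alternating reflections. -/
theorem IsSimpleBasis.exists_alternating (h : IsReflectionStable B Φ) (hb : IsSimpleBasis Φ b)
    (ι : F →+* ℝ) {i j : I} {θ : ℝ} (hθ : ι (B (b i) (b j)) = -2 * Real.cos θ) (k : ℕ) :
    ∃ x y : F, ι x * Real.sin θ = Real.sin ((k + 1) * θ) ∧ ι y * Real.sin θ = Real.sin (k * θ) ∧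
      x • b i + y • b j ∈ Φ ∧ y • b i + x • b j ∈ Φ := by
  induction k with
  | zero => exact ⟨1, 0, by simp, by simp, by simpa using hb.mem i, by simpa using hb.mem j⟩
  | succ k ih =>
    obtain ⟨x, y, hx, hy, h1, h2⟩ := ih
    have e1 := h.norm _ (hb.mem i)
    have e2 := h.norm _ (hb.mem j)
    -- As `-B (b i) (b j)` maps to `2 cos θ`, this is the recursion `sin ((k+2)θ) = 2 cos θ sin
    -- ((k+1)θ) - sin (kθ)`.
    refine ⟨-B (b i) (b j) * x - y, x, ?_, ?_, ?_, ?_⟩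
    · have s1 : Real.sin ((((k + 1 : ℕ) : ℝ) + 1) * θ) =
          2 * Real.cos θ * Real.sin ((k + 1) * θ) - Real.sin (k * θ) := by
        have t1 : (((k + 1 : ℕ) : ℝ) + 1) * θ = (k + 1) * θ + θ := by push_cast; ring
        have t2 : (k : ℝ) * θ = (k + 1) * θ - θ := by ring
        rw [t1, t2, Real.sin_add, Real.sin_sub]
        ring
      rw [s1, ← hx, ← hy, map_sub, map_mul, map_neg, hθ]
      ring
    · push_cast
      exact hx
    · have := h.reflect _ (hb.mem i) _ h2
      convert this using 1
      simp only [map_add, map_smul, e1, smul_eq_mul]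
      module
    · have := h.reflect _ (hb.mem j) _ h1
      convert this using 1
      simp only [map_add, map_smul, e2, smul_eq_mul, h.symm (b j) (b i)]
      module

/-- If `π / θ` is not an integer, some `k` has `kθ < π < (k+1)θ`, and the two sines have opposite
signs. -/
theorem exists_eq_pi_div_of_sin_mul_sin_nonneg {θ : ℝ} (h0 : 0 < θ) (h1 : θ ≤ Real.pi / 2)
    (hθ : ∀ k : ℕ, 0 ≤ Real.sin ((k + 1) * θ) * Real.sin (k * θ)) :
    ∃ m : ℕ, 2 ≤ m ∧ θ = Real.pi / m := by
  have hpi := Real.pi_pos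
  have h2 : 2 ≤ Real.pi / θ := by rw [le_div_iff₀ h0]; linarith
  obtain ⟨k, hk⟩ : ∃ k : ℕ, ⌈Real.pi / θ⌉₊ = k + 1 :=
    Nat.exists_eq_succ_of_ne_zero (Nat.ceil_pos.2 (by linarith)).ne'
  have hle := Nat.le_ceil (Real.pi / θ)
  have hlt := Nat.ceil_lt_add_one (a := Real.pi / θ) (by linarith)
  rw [hk] at hle hlt
  push_cast at hle hlt
  have hk1 : (0 : ℝ) < k := by linarith
  have hk1' : 0 < k := by exact_mod_cast hk1
  rw [div_le_iff₀ h0] at hle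
  have hlt' : (k : ℝ) * θ < Real.pi := by rw [← lt_div_iff₀ h0]; linarith
  refine ⟨k + 1, by omega, ?_⟩
  push_cast
  rw [eq_div_iff (by positivity)]
  by_contra hne
  have hgt : Real.pi < (k + 1) * θ := lt_of_le_of_ne hle (by rw [mul_comm]; exact fun e => hne e.symm)
  have s1 : 0 < Real.sin (k * θ) := Real.sin_pos_of_pos_of_lt_pi (by positivity) hlt'
  have s2 : 0 < Real.sin ((k + 1) * θ - Real.pi) :=
    Real.sin_pos_of_pos_of_lt_pi (by linarith) (by linarith)
  rw [Real.sin_sub_pi] at s2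
  nlinarith [hθ k]

theorem IsSimpleBasis.exists_label (h : IsReflectionStable B Φ) (hb : IsSimpleBasis Φ b)
    (ι : F →+* ℝ) (hι : StrictMono ι) {i j : I} (hij : i ≠ j) :
    ∃ m : ℕ, 2 ≤ m ∧ ι (B (b i) (b j)) = -2 * Real.cos (Real.pi / m) := by
  have hle : ι (B (b i) (b j)) ≤ 0 := by
    simpa using hι.monotone (IsSimpleBasis.apply_nonpos h hb hij)
  have hgt : -2 < ι (B (b i) (b j)) := by
    simpa only [map_neg, map_ofNat] using hι (IsSimpleBasis.neg_two_lt_apply h hb hij)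
  set θ := Real.arccos (-ι (B (b i) (b j)) / 2) with hθ
  have hcos : ι (B (b i) (b j)) = -2 * Real.cos θ := by
    rw [hθ, Real.cos_arccos (by linarith) (by linarith)]
    ring
  have h0 : 0 < θ := Real.arccos_pos.2 (by linarith)
  have h1 : θ ≤ Real.pi / 2 := Real.arccos_le_pi_div_two.2 (by linarith)
  have hsin : 0 < Real.sin θ := Real.sin_pos_of_pos_of_lt_pi h0 (by linarith [Real.pi_pos])
  obtain ⟨m, hm, e⟩ := exists_eq_pi_div_of_sin_mul_sin_nonneg h0 h1 fun k => by
    obtain ⟨x, y, hx, hy, hΦ, -⟩ := hb.exists_alternating h ι hcos k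
    rw [← hx, ← hy]
    have key := hb.sign _ hΦ
    simp only [map_add, map_smul, Basis.repr_self, Finsupp.add_apply, Finsupp.smul_apply,
      smul_eq_mul] at key
    have hxy : 0 ≤ x * y := by
      rcases key with key | key
      · have k1 := key i
        have k2 := key j
        simp [hij, hij.symm] at k1 k2
        exact mul_nonneg k1 k2
      · have k1 := key i
        have k2 := key j
        simp [hij, hij.symm] at k1 k2
        exact mul_nonneg_of_nonpos_of_nonpos k1 k2
    have hxy' : 0 ≤ ι x * ι y := by
      simpa using hι.monotone hxy
    nlinarith [mul_nonneg hxy' (mul_nonneg hsin.le hsin.le)]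
  exact ⟨m, hm, by rw [hcos, e]⟩

theorem cos_pi_div_le_cos_pi_div {m n : ℕ} (hm : 0 < m) (hmn : m ≤ n) :
    Real.cos (Real.pi / m) ≤ Real.cos (Real.pi / n) := by
  have hpi := Real.pi_pos
  have hm' : (1 : ℝ) ≤ m := by exact_mod_cast hm
  have hmn' : (m : ℝ) ≤ n := by exact_mod_cast hmn
  refine Real.cos_le_cos_of_nonneg_of_le_pi (by positivity) (div_le_self hpi.le hm') ?_
  gcongr

theorem cos_pi_div_injective {m n : ℕ} (hm : 0 < m) (hn : 0 < n)
    (h : Real.cos (Real.pi / m) = Real.cos (Real.pi / n)) : m = n := by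
  have hpi := Real.pi_pos
  have hm' : (1 : ℝ) ≤ m := by exact_mod_cast hm
  have hn' : (1 : ℝ) ≤ n := by exact_mod_cast hn
  have := Real.injOn_cos ⟨by positivity, div_le_self hpi.le hm'⟩
    ⟨by positivity, div_le_self hpi.le hn'⟩ h
  rw [div_eq_div_iff (by positivity) (by positivity)] at this
  exact_mod_cast (mul_left_cancel₀ hpi.ne' this).symm

theorem apply_eq_sum_repr [Fintype I] (b : Basis I F V) (x y : V) :
    B x y = ∑ i, b.repr y i * B x (b i) := by
  conv_lhs => rw [← b.sum_repr y]
  simp only [map_sum, map_smul, smul_eq_mul]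

/-- The coordinates of a positive root are `0` or at least `1`, and they lie in every subring that
contains the inner products of the roots. -/
theorem IsSimpleBasis.repr_mem [Fintype I] (h : IsReflectionStable B Φ) (hb : IsSimpleBasis Φ b)
    (R : Subring F) (hR : ∀ x ∈ Φ, ∀ y ∈ Φ, B x y ∈ R)
    (hgap : ∀ i j, i ≠ j → B (b i) (b j) = 0 ∨ B (b i) (b j) ≤ -1)
    {γ : V} (hγ : γ ∈ Φ) (hγ0 : ∀ i, 0 ≤ b.repr γ i) (i : I) :
    b.repr γ i ∈ R ∧ (b.repr γ i = 0 ∨ 1 ≤ b.repr γ i) := by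
  classical
  by_contra hcon
  set S : Set V := {γ | γ ∈ Φ ∧ (∀ i, 0 ≤ b.repr γ i) ∧
    ¬ ∀ i, b.repr γ i ∈ R ∧ (b.repr γ i = 0 ∨ 1 ≤ b.repr γ i)}
  -- Descent: a bad positive root of least coordinate sum is reflected in a simple root with which
  -- its product is positive, which exists because its norm is positive.
  obtain ⟨γ, ⟨hγ, hγ0, hbad⟩, hmin⟩ := Set.exists_min_image S (fun γ => ∑ i, b.repr γ i)
    (h.finite.subset fun x hx => hx.1) ⟨γ, hγ, hγ0, fun hall => hcon (hall i)⟩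
  clear hcon
  obtain ⟨i, hi⟩ : ∃ i, 0 < b.repr γ i * B (b i) γ := by
    by_contra! hc
    have e : B γ γ = ∑ i, b.repr γ i * B (b i) γ := by
      simp only [apply_eq_sum_repr b γ γ, h.symm γ]
    have := h.norm γ hγ
    have h2 : ∑ i, b.repr γ i * B (b i) γ ≤ 0 := Finset.sum_nonpos fun i _ => hc i
    linarith
  have hBi : 0 < B (b i) γ := pos_of_mul_pos_right hi (hγ0 i)
  set δ := γ - B (b i) γ • b i with hδ
  have hδΦ : δ ∈ Φ := h.reflect _ (hb.mem i) _ hγ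
  have hδi : b.repr δ i = b.repr γ i - B (b i) γ := by simp [hδ]
  have hδj : ∀ j, j ≠ i → b.repr δ j = b.repr γ j := fun j hj => by simp [hδ, hj.symm]
  -- Otherwise `γ` would be `b i`, which is not bad. The reflection keeps the positive coordinate at
  -- `j`, so `δ` is again a positive root.
  have hother : ∃ j, j ≠ i ∧ 0 < b.repr γ j := by
    by_contra! hc
    have hz : ∀ j, j ≠ i → b.repr γ j = 0 := fun j hj => le_antisymm (hc j hj) (hγ0 j)
    have e : γ = b.repr γ i • b i := by
      conv_lhs => rw [← b.sum_repr γ]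
      rw [Finset.sum_eq_single i (fun j _ hj => by rw [hz j hj, zero_smul]) (by simp)]
    have hsq : b.repr γ i * b.repr γ i = 1 := by
      have := h.norm γ hγ
      generalize b.repr γ i = t at e
      subst e
      simp only [map_smul, LinearMap.smul_apply, smul_eq_mul, h.norm _ (hb.mem i)] at this
      linarith
    have h1 : b.repr γ i = 1 := by
      rcases mul_self_eq_one_iff.1 hsq with h1 | h1
      · exact h1
      · have := hγ0 i
        rw [h1] at this
        exact absurd this (by norm_num)
    refine hbad fun j => ?_
    by_cases hj : j = i
    · rw [hj, h1]; exact ⟨R.one_mem, Or.inr le_rfl⟩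
    · rw [hz j hj]; exact ⟨R.zero_mem, Or.inl rfl⟩
  obtain ⟨j, hji, hj⟩ := hother
  have hδ0 : ∀ k, 0 ≤ b.repr δ k := by
    rcases hb.sign δ hδΦ with h1 | h1
    · exact h1
    · have := h1 j
      rw [hδj j hji] at this
      exact absurd hj this.not_gt
  have hδgood : ∀ k, b.repr δ k ∈ R ∧ (b.repr δ k = 0 ∨ 1 ≤ b.repr δ k) := by
    by_contra hc
    have := hmin δ ⟨hδΦ, hδ0, hc⟩
    have e : ∑ k, b.repr δ k = ∑ k, b.repr γ k - B (b i) γ := by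
      simp [hδ, Finset.sum_sub_distrib]
    simp only [e] at this
    linarith
  refine hbad fun k => ?_
  by_cases hk : k = i
  · subst hk
    have hval : b.repr γ k = b.repr δ k + B (b k) γ := by rw [hδi]; ring
    rw [hval]
    refine ⟨R.add_mem (hδgood k).1 (hR _ (hb.mem k) _ hγ), Or.inr ?_⟩
    rcases (hδgood k).2 with h0 | h1
    -- When `δ` has no `k`-coordinate, that of `γ` is `B (b k) γ = -B (b k) δ`: a positive sum of
    -- terms each `0` or at least `1`.
    · have e : B (b k) γ = ∑ l, b.repr δ l * -B (b k) (b l) := by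
        have e1 : B (b k) δ = -B (b k) γ := by
          simp only [hδ, map_sub, map_smul, smul_eq_mul, h.norm _ (hb.mem k)]
          ring
        rw [apply_eq_sum_repr b] at e1
        simp only [mul_neg, Finset.sum_neg_distrib, e1, neg_neg]
      have hterm : ∀ l, b.repr δ l * -B (b k) (b l) = 0 ∨ 1 ≤ b.repr δ l * -B (b k) (b l) := by
        intro l
        by_cases hl : k = l
        · left; rw [← hl, h0, zero_mul]
        rcases hgap k l hl with h2 | h2
        · left; rw [h2, neg_zero, mul_zero]
        rcases (hδgood l).2 with h3 | h3
        · left; rw [h3, zero_mul]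
        · right; nlinarith
      have hnn : ∀ l, 0 ≤ b.repr δ l * -B (b k) (b l) := fun l => by
        rcases hterm l with h2 | h2 <;> linarith
      rw [h0, zero_add, e]
      rw [e] at hBi
      obtain ⟨l, -, hl⟩ := Finset.exists_lt_of_sum_lt (s := Finset.univ) (f := fun _ => (0 : F))
        (g := fun l => b.repr δ l * -B (b k) (b l)) (by simpa using hBi)
      rcases hterm l with h2 | h2
      · exact absurd h2 hl.ne'
      · exact h2.trans (Finset.single_le_sum (fun l _ => hnn l) (Finset.mem_univ l))
    · linarith
  · rw [← hδj k hk]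
    exact hδgood k

end ReflectionSystem

/-! ### Positive definite forms on connected Coxeter diagrams. -/

namespace CoxeterForm

open Module

variable {F V : Type*} [Field F] [LinearOrder F] [IsStrictOrderedRing F]
  [AddCommGroup V] [Module F V]

/-- A family of vectors of norm `2` whose inner products are bounded by those that a Coxeter
matrix prescribes, for a positive definite form and a connected Coxeter diagram. -/
structure IsRealization {I : Type*} (B : LinearMap.BilinForm F V) (v : I → V)
    (M : CoxeterMatrix I) : Prop where
  symm : ∀ x y, B x y = B y x
  pos : ∀ x, x ≠ 0 → 0 < B x x
  linearIndependent : LinearIndependent F v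
  norm : ∀ i, B (v i) (v i) = 2
  label_ne_zero : ∀ i j, M i j ≠ 0
  nonpos : ∀ i j, i ≠ j → B (v i) (v j) ≤ 0
  le_of_three_le : ∀ i j, 3 ≤ M i j → B (v i) (v j) ≤ -1
  sq_of_four_le : ∀ i j, 4 ≤ M i j → 2 ≤ B (v i) (v j) ^ 2
  -- `8 / 5` is a rational bound below `2 cos (π / 5)`; the squares `2` and `3` are `4 cos² (π / 4)`
  -- and `4 cos² (π / 6)`. No irrational number is needed in `F`.
  le_of_five_le : ∀ i j, 5 ≤ M i j → B (v i) (v j) ≤ -(8 / 5)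
  sq_of_six_le : ∀ i j, 6 ≤ M i j → 3 ≤ B (v i) (v j) ^ 2
  connected : ∀ S : Set I, S.Nonempty → (∃ j, j ∉ S) → ∃ i ∈ S, ∃ j, j ∉ S ∧ 3 ≤ M i j

variable {I : Type*} {B : LinearMap.BilinForm F V} {v : I → V} {M : CoxeterMatrix I}

namespace IsRealization

/-- It certifies that a nonnegative combination with a positive coefficient is nonzero. -/
theorem exists_dual (h : IsRealization B v M) : ∃ f : Dual F V, ∀ i, f (v i) = 1 := by
  obtain ⟨f, hf⟩ := Module.exists_dual_forall_apply_eq_one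
    (linearIndepOn_univ_iff.2 h.linearIndependent)
  exact ⟨f, fun i => hf i (Set.mem_univ i)⟩

theorem three_le_of_ne_two (h : IsRealization B v M) {i j : I} (hij : i ≠ j) (h2 : M i j ≠ 2) :
    3 ≤ M i j := by
  have := h.label_ne_zero i j
  have := M.off_diagonal i j hij
  omega

/-- An upper bound for the norm of a nonnegative combination along a tree,
where `π t` is the parent of the vertex `t`. -/
theorem apply_sum_le (h : IsRealization B v M) (f : ℕ → I) (c r : ℕ → F) (π : ℕ → ℕ)
    (hc : ∀ t, 0 ≤ c t) (n : ℕ) (hf : ∀ s ≤ n, ∀ t ≤ n, f s = f t → s = t)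
    (hπ : ∀ t < n, π t ≤ t) (hr : ∀ t < n, B (v (f (π t))) (v (f (t + 1))) ≤ -r t) :
    B (∑ t ∈ Finset.range (n + 1), c t • v (f t)) (∑ t ∈ Finset.range (n + 1), c t • v (f t)) ≤
      2 * c 0 ^ 2 +
        ∑ t ∈ Finset.range n, (2 * c (t + 1) ^ 2 - 2 * (r t * c (t + 1) * c (π t))) := by
  induction n with
  | zero => simp [h.norm]; nlinarith
  | succ n ih =>
    have ih' := ih (fun s hs t ht => hf s (by omega) t (by omega)) (fun t ht => hπ t (by omega))
      (fun t ht => hr t (by omega))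
    rw [Finset.sum_range_succ (fun t => c t • v (f t)) (n + 1)]
    set u := ∑ t ∈ Finset.range (n + 1), c t • v (f t) with hu
    rw [Finset.sum_range_succ _ n]
    -- Only the edge to the parent is kept; all other products are nonpositive and may be dropped.
    have key : B u (v (f (n + 1))) ≤ c (π n) * -r n := by
      have e : B u (v (f (n + 1))) =
          ∑ t ∈ Finset.range (n + 1), c t * B (v (f t)) (v (f (n + 1))) := by
        simp [hu, map_sum, LinearMap.sum_apply]
      have hmem : π n ∈ Finset.range (n + 1) := by
        have := hπ n (by omega)
        simp; omega
      rw [e, ← Finset.add_sum_erase _ _ hmem]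
      have h1 : ∑ t ∈ (Finset.range (n + 1)).erase (π n), c t * B (v (f t)) (v (f (n + 1))) ≤ 0 := by
        refine Finset.sum_nonpos fun t ht => mul_nonpos_of_nonneg_of_nonpos (hc t) ?_
        refine h.nonpos _ _ fun e => ?_
        simp only [Finset.mem_erase, Finset.mem_range] at ht
        have := hf t (by omega) (n + 1) le_rfl e
        omega
      have h2 := mul_le_mul_of_nonneg_left (hr n (by omega)) (hc (π n))
      linarith
    have key' := mul_le_mul_of_nonneg_left key (hc (n + 1))
    simp only [map_add, LinearMap.add_apply, map_smul, LinearMap.smul_apply, smul_eq_mul, h.norm,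
      h.symm (v (f (n + 1))) u]
    nlinarith

/-- This is the exclusion test: a tree is impossible once weights `c` make the right-hand side
nonpositive. -/
theorem pos_of_tree (h : IsRealization B v M) (f : ℕ → I) (c r : ℕ → F) (π : ℕ → ℕ)
    (hc : ∀ t, 0 ≤ c t) (hc0 : 0 < c 0) (n : ℕ) (hf : ∀ s ≤ n, ∀ t ≤ n, f s = f t → s = t)
    (hπ : ∀ t < n, π t ≤ t) (hr : ∀ t < n, B (v (f (π t))) (v (f (t + 1))) ≤ -r t) :
    0 < 2 * c 0 ^ 2 +
      ∑ t ∈ Finset.range n, (2 * c (t + 1) ^ 2 - 2 * (r t * c (t + 1) * c (π t))) := by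
  refine lt_of_lt_of_le (h.pos _ fun h0 => ?_) (h.apply_sum_le f c r π hc n hf hπ hr)
  obtain ⟨φ, hφ⟩ := h.exists_dual
  have := congrArg φ h0
  simp only [map_sum, map_smul, hφ, smul_eq_mul, mul_one, map_zero] at this
  rw [Finset.sum_range_succ'] at this
  have := Finset.sum_nonneg (s := Finset.range n) (fun t _ => hc (t + 1))
  linarith

/-- The sum of the vectors of a set `S` of vertices. -/
def vec (v : I → V) (S : Finset I) : V := ∑ i ∈ S, v i

theorem vec_apply_le (h : IsRealization B v M) {S T : Finset I} (hTS : T ⊆ S) {k : I}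
    (hk : k ∉ S) : B (vec v S) (v k) ≤ ∑ i ∈ T, B (v i) (v k) := by
  classical
  have e : B (vec v S) (v k) = ∑ i ∈ S, B (v i) (v k) := by
    simp [vec, map_sum, LinearMap.sum_apply]
  rw [e, ← Finset.sum_sdiff hTS]
  have : ∑ i ∈ S \ T, B (v i) (v k) ≤ 0 := Finset.sum_nonpos fun i hi =>
    h.nonpos _ _ fun e => hk (e ▸ (Finset.mem_sdiff.1 hi).1)
  linarith

theorem vec_apply_le_of_mem (h : IsRealization B v M) {S : Finset I} {i k : I} (hi : i ∈ S)
    (hk : k ∉ S) : B (vec v S) (v k) ≤ B (v i) (v k) := by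
  simpa using h.vec_apply_le (T := {i}) (by simpa using hi) hk

/-- A set of vertices whose vectors have a sum of norm at most `2`, as for a connected set. -/
def IsTight (B : LinearMap.BilinForm F V) (v : I → V) (S : Finset I) : Prop :=
  S.Nonempty ∧ B (vec v S) (vec v S) ≤ 2

/-- Contracting a connected set to a point leaves a star, the squares of whose weights have a sum
less than `4`. -/
theorem sum_sq_lt_four (h : IsRealization B v M) {S T : Finset I} (hS : IsTight B v S)
    (hT : ∀ j ∈ T, j ∉ S) : ∑ j ∈ T, B (vec v S) (v j) ^ 2 < 4 := by
  set u := vec v S with hu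
  have hb : ∀ j ∈ T, 0 ≤ -B u (v j) := fun j hj => by
    obtain ⟨i, hi⟩ := hS.1
    have h1 := h.vec_apply_le_of_mem hi (hT j hj)
    have h2 := h.nonpos i j fun e => hT j hj (e ▸ hi)
    linarith
  set w := ∑ j ∈ T, (-B u (v j)) • v j with hw
  -- With `s` the sum of squares, this test vector has norm at most `8 - 4 * s + 2 * s`, whence `s <
  -- 4`.
  have hne : (2 : F) • u + w ≠ 0 := by
    intro h0
    obtain ⟨φ, hφ⟩ := h.exists_dual
    have := congrArg φ h0
    have e : φ u = S.card := by simp [hu, vec, hφ]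
    simp only [map_add, map_smul, e, smul_eq_mul, map_zero, hw, map_sum, hφ, mul_one] at this
    have h1 : (0 : F) < S.card := by exact_mod_cast hS.1.card_pos
    have h2 := Finset.sum_nonneg hb
    linarith
  have hpos := h.pos _ hne
  have e1 : B u w = -∑ j ∈ T, B u (v j) ^ 2 := by
    rw [hw, map_sum, ← Finset.sum_neg_distrib]
    refine Finset.sum_congr rfl fun j _ => ?_
    rw [map_smul, smul_eq_mul]
    ring
  have e2 : B w w ≤ 2 * ∑ j ∈ T, B u (v j) ^ 2 := by
    have e : B w w = ∑ j ∈ T, -B u (v j) * B w (v j) := by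
      conv_lhs => rw [hw]
      rw [map_sum]
      refine Finset.sum_congr rfl fun j _ => ?_
      rw [map_smul, smul_eq_mul]
    rw [e, Finset.mul_sum]
    refine Finset.sum_le_sum fun j hj => ?_
    have h1 : B w (v j) ≤ 2 * -B u (v j) := by
      classical
      have e' : B w (v j) = ∑ i ∈ T, -B u (v i) * B (v i) (v j) := by
        rw [hw, map_sum, LinearMap.sum_apply]
        refine Finset.sum_congr rfl fun i _ => ?_
        rw [map_smul, LinearMap.smul_apply, smul_eq_mul]
      rw [e', ← Finset.add_sum_erase _ _ hj, h.norm]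
      have : ∑ i ∈ T.erase j, -B u (v i) * B (v i) (v j) ≤ 0 := Finset.sum_nonpos fun i hi =>
        mul_nonpos_of_nonneg_of_nonpos (hb i (Finset.mem_of_mem_erase hi))
          (h.nonpos _ _ (Finset.ne_of_mem_erase hi))
      linarith
    have := mul_le_mul_of_nonneg_left h1 (hb j hj)
    linarith
  simp only [map_add, LinearMap.add_apply, map_smul, LinearMap.smul_apply, smul_eq_mul,
    h.symm w u, e1] at hpos
  have := hS.2
  linarith

theorem le_vec_apply_sq (h : IsRealization B v M) {S : Finset I} {i k : I} (hi : i ∈ S)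
    (hk : k ∉ S) : B (v i) (v k) ^ 2 ≤ B (vec v S) (v k) ^ 2 := by
  have h1 := h.vec_apply_le_of_mem hi hk
  have h2 := h.nonpos i k fun e => hk (e ▸ hi)
  nlinarith

theorem one_le_sq (h : IsRealization B v M) {i k : I} (hik : 3 ≤ M i k) :
    1 ≤ B (v i) (v k) ^ 2 := by
  have := h.le_of_three_le i k hik
  nlinarith

/-- A vertex is joined to at most one vertex of a connected set that does not contain it. -/
theorem eq_of_adj_of_adj (h : IsRealization B v M) {S : Finset I} (hS : IsTight B v S)
    {i j k : I} (hi : i ∈ S) (hj : j ∈ S) (hk : k ∉ S) (hik : 3 ≤ M i k) (hjk : 3 ≤ M j k) :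
    i = j := by
  classical
  by_contra hij
  -- Two edges to `k` make this product at most `-2`, with square at least `4`.
  have h1 := h.vec_apply_le (S := S) (T := {i, j}) (by simp [Finset.insert_subset_iff, hi, hj]) hk
  rw [Finset.sum_pair hij] at h1
  have h2 := h.le_of_three_le _ _ hik
  have h3 := h.le_of_three_le _ _ hjk
  have h4 := h.sum_sq_lt_four hS (T := {k}) (by simpa using hk)
  rw [Finset.sum_singleton] at h4
  nlinarith

/-- Each edge leaving `S` contributes at least `1` to a sum that stays below `4`; below, a label of
at least `4` contributes at least `2`. -/
theorem false_of_four_adj (h : IsRealization B v M) {S : Finset I} (hS : IsTight B v S)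
    {i₁ i₂ i₃ i₄ j₁ j₂ j₃ j₄ : I} (h₁ : i₁ ∈ S) (h₂ : i₂ ∈ S) (h₃ : i₃ ∈ S) (h₄ : i₄ ∈ S)
    (k₁ : j₁ ∉ S) (k₂ : j₂ ∉ S) (k₃ : j₃ ∉ S) (k₄ : j₄ ∉ S)
    (hne : [j₁, j₂, j₃, j₄].Nodup) (a₁ : 3 ≤ M i₁ j₁) (a₂ : 3 ≤ M i₂ j₂) (a₃ : 3 ≤ M i₃ j₃)
    (a₄ : 3 ≤ M i₄ j₄) : False := by
  classical
  have key := h.sum_sq_lt_four hS (T := {j₁, j₂, j₃, j₄}) (by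
    simp only [Finset.mem_insert, Finset.mem_singleton]
    rintro j (rfl | rfl | rfl | rfl) <;> assumption)
  simp only [List.nodup_cons, List.mem_cons, List.not_mem_nil, not_or, or_false, not_false_eq_true,
    List.nodup_nil, and_true] at hne
  rw [Finset.sum_insert (by simp [hne]), Finset.sum_insert (by simp [hne]),
    Finset.sum_insert (by simp [hne]), Finset.sum_singleton] at key
  linarith [h.le_vec_apply_sq h₁ k₁, h.le_vec_apply_sq h₂ k₂, h.le_vec_apply_sq h₃ k₃,
    h.le_vec_apply_sq h₄ k₄, h.one_le_sq a₁, h.one_le_sq a₂, h.one_le_sq a₃, h.one_le_sq a₄]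

theorem false_of_heavy_of_two_adj (h : IsRealization B v M) {S : Finset I} (hS : IsTight B v S)
    {i₁ i₂ i₃ j₁ j₂ j₃ : I} (h₁ : i₁ ∈ S) (h₂ : i₂ ∈ S) (h₃ : i₃ ∈ S)
    (k₁ : j₁ ∉ S) (k₂ : j₂ ∉ S) (k₃ : j₃ ∉ S) (hne : [j₁, j₂, j₃].Nodup)
    (a₁ : 4 ≤ M i₁ j₁) (a₂ : 3 ≤ M i₂ j₂) (a₃ : 3 ≤ M i₃ j₃) : False := by
  classical
  have key := h.sum_sq_lt_four hS (T := {j₁, j₂, j₃}) (by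
    simp only [Finset.mem_insert, Finset.mem_singleton]
    rintro j (rfl | rfl | rfl) <;> assumption)
  simp only [List.nodup_cons, List.mem_cons, List.not_mem_nil, not_or, or_false, not_false_eq_true,
    List.nodup_nil, and_true] at hne
  rw [Finset.sum_insert (by simp [hne]), Finset.sum_insert (by simp [hne]),
    Finset.sum_singleton] at key
  linarith [h.le_vec_apply_sq h₁ k₁, h.le_vec_apply_sq h₂ k₂, h.le_vec_apply_sq h₃ k₃,
    h.sq_of_four_le _ _ a₁, h.one_le_sq a₂, h.one_le_sq a₃]

theorem false_of_two_adj (h : IsRealization B v M) {S : Finset I} (hS : IsTight B v S)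
    {i₁ i₂ j₁ j₂ : I} (h₁ : i₁ ∈ S) (h₂ : i₂ ∈ S) (k₁ : j₁ ∉ S) (k₂ : j₂ ∉ S) (hne : j₁ ≠ j₂)
    (hsq : 4 ≤ B (v i₁) (v j₁) ^ 2 + B (v i₂) (v j₂) ^ 2) : False := by
  classical
  have key := h.sum_sq_lt_four hS (T := {j₁, j₂}) (by
    simp only [Finset.mem_insert, Finset.mem_singleton]
    rintro j (rfl | rfl) <;> assumption)
  rw [Finset.sum_pair hne] at key
  linarith [h.le_vec_apply_sq h₁ k₁, h.le_vec_apply_sq h₂ k₂]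

end IsRealization

/-! ### Paths -/

/-- The vertices `p 0, …, p (k - 1)` form a path. -/
structure IsPath (M : CoxeterMatrix I) (p : ℕ → I) (k : ℕ) : Prop where
  inj : ∀ s < k, ∀ t < k, p s = p t → s = t
  adj : ∀ t, t + 1 < k → 3 ≤ M (p t) (p (t + 1))

namespace IsPath

variable {p : ℕ → I} {k : ℕ}

theorem drop (hp : IsPath M p k) (j : ℕ) : IsPath M (fun t => p (j + t)) (k - j) where
  inj s hs t ht e := by
    have := hp.inj _ (by omega) _ (by omega) e
    omega
  adj t ht := hp.adj (j + t) (by omega)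

theorem reverse (hp : IsPath M p k) : IsPath M (fun t => p (k - 1 - t)) k where
  inj s hs t ht e := by
    have := hp.inj _ (by omega) _ (by omega) e
    omega
  adj t ht := by
    have := hp.adj (k - 1 - (t + 1)) (by omega)
    rw [M.symmetric, show k - 1 - (t + 1) + 1 = k - 1 - t by omega] at this
    exact this

theorem cons (hp : IsPath M p k) {w : I} (hw : ∀ t < k, p t ≠ w) (hadj : 0 < k → 3 ≤ M w (p 0)) :
    IsPath M (fun t => if t = 0 then w else p (t - 1)) (k + 1) where
  inj s hs t ht e := by
    rcases Nat.eq_zero_or_pos s with rfl | hs0 <;> rcases Nat.eq_zero_or_pos t with rfl | ht0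
    · rfl
    · rw [if_pos rfl, if_neg ht0.ne'] at e
      exact absurd e.symm (hw _ (by omega))
    · rw [if_pos rfl, if_neg hs0.ne'] at e
      exact absurd e (hw _ (by omega))
    · rw [if_neg hs0.ne', if_neg ht0.ne'] at e
      have := hp.inj _ (by omega) _ (by omega) e
      omega
  adj t ht := by
    rcases Nat.eq_zero_or_pos t with rfl | ht0
    · simpa using hadj (by omega)
    · have := hp.adj (t - 1) (by omega)
      rw [if_neg ht0.ne', if_neg (by omega)]
      rwa [Nat.sub_add_cancel ht0] at this

theorem le_card [Fintype I] (hp : IsPath M p k) : k ≤ Fintype.card I := by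
  have : Function.Injective fun t : Fin k => p t := fun s t e =>
    Fin.ext (hp.inj _ s.2 _ t.2 e)
  simpa using Fintype.card_le_of_injective _ this

variable [DecidableEq I]

/-- The vertices `p a, …, p (b - 1)`. -/
def seg (p : ℕ → I) (a b : ℕ) : Finset I := (Finset.Ico a b).image p

theorem mem_seg (hp : IsPath M p k) {a b t : ℕ} (hb : b ≤ k) (ht : t < k) :
    p t ∈ seg p a b ↔ a ≤ t ∧ t < b := by
  simp only [seg, Finset.mem_image, Finset.mem_Ico]
  constructor
  · rintro ⟨s, hs, e⟩
    rwa [← hp.inj _ (by omega) _ ht e]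
  · exact fun h => ⟨t, h, rfl⟩

theorem notMem_seg {w : I} {a b : ℕ} (hb : b ≤ k) (hw : ∀ t < k, p t ≠ w) : w ∉ seg p a b := by
  simp only [seg, Finset.mem_image, Finset.mem_Ico, not_exists, not_and]
  exact fun t ht => hw t (by omega)

/-- With unit weights, each further vertex adds `2` and its edge removes at least `2`. -/
theorem isTight_seg (hp : IsPath M p k) (h : IsRealization B v M) {a b : ℕ} (hab : a < b)
    (hb : b ≤ k) : IsRealization.IsTight B v (seg p a b) := by
  refine ⟨⟨p a, by simp only [seg, Finset.mem_image, Finset.mem_Ico]; exact ⟨a, by omega, rfl⟩⟩, ?_⟩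
  have e : IsRealization.vec v (seg p a b) =
      ∑ t ∈ Finset.range (b - a - 1 + 1), (fun _ => (1 : F)) t • v (p (a + t)) := by
    rw [IsRealization.vec, seg, Finset.sum_image fun s hs t ht e => hp.inj _
      (by simp at hs; omega) _ (by simp at ht; omega) e, Finset.sum_Ico_eq_sum_range,
      show b - a - 1 + 1 = b - a by omega]
    simp
  rw [e]
  refine (h.apply_sum_le (fun t => p (a + t)) (fun _ => 1) (fun _ => 1) id
    (fun _ => zero_le_one) (b - a - 1) (fun s hs t ht e => ?_) (fun t _ => le_rfl)
    (fun t ht => h.le_of_three_le _ _ (hp.adj (a + t) (by omega)))).trans ?_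
  · have := hp.inj _ (by omega) _ (by omega) e
    omega
  · simp

/-- A chord would close a cycle: `p t` would be joined to both `p s` and `p (t - 1)` in a tight
segment. -/
theorem eq_two (hp : IsPath M p k) (h : IsRealization B v M) {s t : ℕ} (hst : s + 1 < t)
    (ht : t < k) : M (p s) (p t) = 2 := by
  by_contra hne
  have h3 : 3 ≤ M (p s) (p t) := h.three_le_of_ne_two
    (fun e => by have := hp.inj s (by omega) t ht e; omega) hne
  have hadj := hp.adj (t - 1) (by omega)
  rw [show t - 1 + 1 = t by omega] at hadj
  have := h.eq_of_adj_of_adj (hp.isTight_seg h (a := s) (b := t) (by omega) (by omega))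
    (i := p s) (j := p (t - 1)) (k := p t)
    ((hp.mem_seg (by omega) (by omega)).2 (by omega))
    ((hp.mem_seg (by omega) (by omega)).2 (by omega))
    (fun hm => by have := (hp.mem_seg (by omega) (by omega)).1 hm; omega) h3 hadj
  have := hp.inj _ (by omega) _ (by omega) this
  omega

end IsPath

end CoxeterForm

namespace CoxeterForm

open Module LabelledGraph

variable {F V : Type*} [Field F] [LinearOrder F] [IsStrictOrderedRing F]
  [AddCommGroup V] [Module F V]
  {I : Type*} {B : LinearMap.BilinForm F V} {v : I → V} {M : CoxeterMatrix I}
  {p : ℕ → I} {k : ℕ}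

/-! ### Excluded subdiagrams -/

theorem inj_append {f : ℕ → I} {m : ℕ} {w : I} (hf : ∀ s < m, ∀ t < m, f s = f t → s = t)
    (hw : ∀ t < m, f t ≠ w) (s : ℕ) (hs : s ≤ m) (t : ℕ) (ht : t ≤ m)
    (e : (if s = m then w else f s) = if t = m then w else f t) : s = t := by
  by_cases h1 : s = m <;> by_cases h2 : t = m
  · rw [h1, h2]
  · rw [if_pos h1, if_neg h2] at e
    exact absurd e.symm (hw t (by omega))
  · rw [if_neg h1, if_pos h2] at e
    exact absurd e (hw s (by omega))
  · rw [if_neg h1, if_neg h2] at e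
    exact hf s (by omega) t (by omega) e

/-- The index `k` stands for `w`, whose parent is `p j`. -/
theorem IsPath.fork_pos (hp : IsPath M p k) (h : IsRealization B v M) {w : I}
    (hw : ∀ t < k, p t ≠ w) {j : ℕ} (hj : j < k) (hadj : 3 ≤ M (p j) w) (c : ℕ → ℕ)
    (hc : 0 < c 0) :
    0 < 2 * (c 0 : F) ^ 2 + ∑ t ∈ Finset.range k,
      (2 * (c (t + 1) : F) ^ 2 - 2 * (1 * c (t + 1) * c (if t + 1 = k then j else t))) := by
  refine h.pos_of_tree (fun t => if t = k then w else p t) (fun t => (c t : F)) (fun _ => 1)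
    (fun t => if t + 1 = k then j else t) (fun t => Nat.cast_nonneg _) (Nat.cast_pos.2 hc) k
    (inj_append hp.inj hw) (fun t ht => ?_) (fun t ht => ?_)
  · split_ifs <;> omega
  · refine h.le_of_three_le _ _ ?_
    by_cases h1 : t + 1 = k
    · simp only [h1, if_true]
      rwa [if_neg hj.ne]
    · simp only [h1, if_false]
      rw [if_neg (by omega)]
      exact hp.adj t (by omega)

/-- The weights are the marks of affine `E₆`, with `w` and `x` at indices `5` and `6`; the bound on
the norm is `0`. The next two lemmas use the marks of affine `E₇` and `E₈`, the last one being that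
of `w`. -/
theorem IsPath.false_of_arms_two_two_two (hp : IsPath M p 5) (h : IsRealization B v M) {w x : I}
    (hw : ∀ t < 5, p t ≠ w) (hx : ∀ t < 5, p t ≠ x) (hwx : w ≠ x)
    (hadj : 3 ≤ M (p 2) w) (hadj' : 3 ≤ M w x) : False := by
  have hf := inj_append hp.inj hw
  have key := h.pos_of_tree (fun t => if t = 6 then x else if t = 5 then w else p t)
    (fun t => (([1, 2, 3, 2, 1, 2, 1].getD t 0 : ℕ) : F)) (fun _ => 1)
    (fun t => if t = 4 then 2 else t) (fun t => Nat.cast_nonneg _) (by norm_num) 6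
    (inj_append (fun s hs t ht => hf s (by omega) t (by omega)) (fun t ht => by
      split_ifs with h5
      · exact hwx
      · exact hx t (by omega)))
    (fun t ht => by split_ifs <;> omega) (fun t ht => by
      refine h.le_of_three_le _ _ ?_
      by_cases h4 : t = 4
      · subst h4; simpa using hadj
      by_cases h5 : t = 5
      · subst h5; simpa using hadj'
      · have := hp.adj t (by omega)
        simpa [h4, h5, show t ≠ 6 by omega] using this)
  simp [Finset.sum_range_succ] at key
  norm_num at key

theorem IsPath.false_of_arms_three_three (hp : IsPath M p 7) (h : IsRealization B v M) {w : I}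
    (hw : ∀ t < 7, p t ≠ w) (hadj : 3 ≤ M (p 3) w) : False := by
  have key := hp.fork_pos h hw (by norm_num) hadj ([1, 2, 3, 4, 3, 2, 1, 2].getD · 0) (by norm_num)
  simp [Finset.sum_range_succ] at key
  norm_num at key

theorem IsPath.false_of_arms_two_five (hp : IsPath M p 8) (h : IsRealization B v M) {w : I}
    (hw : ∀ t < 8, p t ≠ w) (hadj : 3 ≤ M (p 2) w) : False := by
  have key := hp.fork_pos h hw (by norm_num) hadj ([2, 4, 6, 5, 4, 3, 2, 1, 3].getD · 0)
    (by norm_num)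
  simp [Finset.sum_range_succ] at key
  norm_num at key

theorem IsPath.path_pos (hp : IsPath M p (k + 1)) (h : IsRealization B v M) (c r : ℕ → F)
    (hc : ∀ t, 0 ≤ c t) (hc0 : 0 < c 0) (hr : ∀ t < k, B (v (p t)) (v (p (t + 1))) ≤ -r t) :
    0 < 2 * c 0 ^ 2 +
      ∑ t ∈ Finset.range k, (2 * c (t + 1) ^ 2 - 2 * (r t * c (t + 1) * c t)) :=
  h.pos_of_tree p c r id hc hc0 k (fun s hs t ht => hp.inj s (by omega) t (by omega))
    (fun t _ => le_rfl) hr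

/-- These weights bound the norm by `-2/5`, so the estimate `8 / 5` suffices; in the next lemma the
bound is `-4/5`. -/
theorem IsPath.false_of_five_first (hp : IsPath M p 5) (h : IsRealization B v M)
    (h5 : 5 ≤ M (p 0) (p 1)) : False := by
  have key := hp.path_pos h (fun t => (([3, 4, 3, 2, 1].getD t 0 : ℕ) : F))
    (fun t => if t = 0 then 8 / 5 else 1) (fun t => Nat.cast_nonneg _) (by norm_num) (fun t ht => by
      split_ifs with h0
      · subst h0; exact h.le_of_five_le _ _ h5
      · exact h.le_of_three_le _ _ (hp.adj t (by omega)))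
  simp [Finset.sum_range_succ] at key
  norm_num at key

theorem IsPath.false_of_five_middle (hp : IsPath M p 4) (h : IsRealization B v M)
    (h5 : 5 ≤ M (p 1) (p 2)) : False := by
  have key := hp.path_pos h (fun t => (([1, 2, 2, 1].getD t 0 : ℕ) : F))
    (fun t => if t = 1 then 8 / 5 else 1) (fun t => Nat.cast_nonneg _) (by norm_num) (fun t ht => by
      split_ifs with h0
      · subst h0; exact h.le_of_five_le _ _ h5
      · exact h.le_of_three_le _ _ (hp.adj t (by omega)))
  simp [Finset.sum_range_succ] at key
  norm_num at key

theorem IsPath.false_of_four_second (hp : IsPath M p 5) (h : IsRealization B v M)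
    (h4 : 4 ≤ M (p 1) (p 2)) : False := by
  have hsq := h.sq_of_four_le _ _ h4
  have hle := h.le_of_three_le _ _ (hp.adj 1 (by norm_num))
  -- The null vector of affine `F₄`, with `r = -B (v (p 1)) (v (p 2))` in place of `√2`: weights `r,
  -- 2r, 3, 2, 1`, bound `12 - 6r² ≤ 0`.
  have key := hp.path_pos h (fun t => if t = 0 then -B (v (p 1)) (v (p 2)) else
      if t = 1 then 2 * -B (v (p 1)) (v (p 2)) else (([3, 2, 1].getD (t - 2) 0 : ℕ) : F))
    (fun t => if t = 1 then -B (v (p 1)) (v (p 2)) else 1)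
    (fun t => by
      split_ifs
      · linarith
      · linarith
      · exact Nat.cast_nonneg _)
    (by simp only [if_true]; linarith) (fun t ht => by
      split_ifs with h0
      · subst h0; rw [neg_neg]
      · exact h.le_of_three_le _ _ (hp.adj t (by omega)))
  simp [Finset.sum_range_succ] at key
  nlinarith

/-! ### The shape of the diagram -/

theorem exists_maximal_path [Fintype I] [Nonempty I] (M : CoxeterMatrix I) :
    ∃ p k, 0 < k ∧ IsPath M p k ∧ ∀ q n, IsPath M q n → n ≤ k := by
  classical
  obtain ⟨i⟩ := ‹Nonempty I›
  have h1 : ∃ p, IsPath M p 1 := ⟨fun _ => i, fun s hs t ht _ => by omega, fun t ht => by omega⟩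
  have hcard : 1 ≤ Fintype.card I := h1.choose_spec.le_card
  obtain ⟨p, hp⟩ := Nat.findGreatest_spec (P := fun n => ∃ p, IsPath M p n) hcard h1
  exact ⟨p, _, Nat.le_findGreatest hcard h1, hp, fun q n hq => Nat.le_findGreatest hq.le_card ⟨q, hq⟩⟩

/-- The vertices of the path `p` and the vertex `w`, joined to `p j`, form a fork. -/
structure IsFork (M : CoxeterMatrix I) (p : ℕ → I) (k : ℕ) (w : I) (j : ℕ) : Prop where
  isPath : IsPath M p k
  ne : ∀ t < k, p t ≠ w
  one_le : 1 ≤ j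
  add_two_le : j + 2 ≤ k
  adj : 3 ≤ M (p j) w

theorem IsFork.reverse {w : I} {j : ℕ} (hf : IsFork M p k w j) :
    IsFork M (fun t => p (k - 1 - t)) k w (k - 1 - j) where
  isPath := hf.isPath.reverse
  ne t ht := hf.ne _ (by omega)
  one_le := by have := hf.add_two_le; omega
  add_two_le := by have := hf.one_le; have := hf.add_two_le; omega
  adj := by
    have := hf.adj
    rwa [show k - 1 - (k - 1 - j) = j by have := hf.add_two_le; omega]

/-- A vertex joined to an end of the path would lengthen it. -/
theorem IsPath.isFork_of_maximal (hp : IsPath M p k) (hmax : ∀ q n, IsPath M q n → n ≤ k) {w : I}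
    (hw : ∀ t < k, p t ≠ w) {j : ℕ} (hj : j < k) (hadj : 3 ≤ M (p j) w) : IsFork M p k w j := by
  have key : ∀ q, IsPath M q k → (∀ t < k, q t ≠ w) → ∀ j < k, 3 ≤ M (q j) w → 1 ≤ j := by
    intro q hq hw j hj hadj
    have := hmax _ _ ((hq.drop j).cons (w := w) (fun t ht => hw _ (by omega))
      (fun _ => by rwa [M.symmetric]))
    omega
  refine ⟨hp, hw, key p hp hw j hj hadj, ?_, hadj⟩
  have := key _ hp.reverse (fun t ht => hw _ (by omega)) (k - 1 - j) (by omega)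
    (by rwa [show k - 1 - (k - 1 - j) = j by omega])
  omega

theorem IsFork.two_le_of_maximal {w : I} {j : ℕ} (hf : IsFork M p k w j)
    (hmax : ∀ q n, IsPath M q n → n ≤ k) {x : I} (hx : ∀ t < k, p t ≠ x) (hwx : w ≠ x)
    (hadj : 3 ≤ M w x) : 2 ≤ j := by
  have hj := hf.add_two_le
  have := hmax _ _ (((hf.isPath.drop j).cons (w := w) (fun t ht => hf.ne _ (by omega))
    (fun _ => by rw [M.symmetric]; exact hf.adj)).cons (w := x) (fun t ht => by
      split_ifs
      · exact hwx
      · exact hx _ (by omega)) (fun _ => by rw [M.symmetric]; exact hadj))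
  omega

/-- A connected diagram with a positive definite form is a path or a fork. -/
theorem IsRealization.exists_path_or_fork [Fintype I] [Nonempty I] (h : IsRealization B v M) :
    (∃ p k, 0 < k ∧ IsPath M p k ∧ ∀ x, ∃ t < k, p t = x) ∨
    (∃ p k w j, IsFork M p k w j ∧ ∀ x, x = w ∨ ∃ t < k, p t = x) := by
  classical
  obtain ⟨p, k, hk, hp, hmax⟩ := exists_maximal_path M
  by_cases hcov : ∀ x, ∃ t < k, p t = x
  · exact Or.inl ⟨p, k, hk, hp, hcov⟩
  right
  obtain ⟨-, ⟨j, hj, rfl⟩, w, hw, hadj⟩ := h.connected {x | ∃ t < k, p t = x} ⟨p 0, 0, hk, rfl⟩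
    (by simpa using hcov)
  replace hw : ∀ t < k, p t ≠ w := by simpa using hw
  have hf := hp.isFork_of_maximal hmax hw hj hadj
  refine ⟨p, k, w, j, hf, ?_⟩
  by_contra hc
  obtain ⟨s, hs, x, hx, hsx⟩ := h.connected {x | x = w ∨ ∃ t < k, p t = x} ⟨w, Or.inl rfl⟩
    (by simpa using hc)
  have hxw : w ≠ x := fun e => hx (Or.inl e.symm)
  have hxp : ∀ t < k, p t ≠ x := fun t ht e => hx (Or.inr ⟨t, ht, e⟩)
  have h1 := hf.one_le
  have h2 := hf.add_two_le
  rcases hs with rfl | ⟨i, hi, rfl⟩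
  -- A vertex beyond `w` gives an arm of length two; by maximality the other two arms are at least
  -- as long, so affine `E₆` appears.
  · have h3 := hf.two_le_of_maximal hmax hxp hxw hsx
    have h4 := hf.reverse.two_le_of_maximal hmax (fun t ht => hxp _ (by omega)) hxw hsx
    have hd := (hp.drop (j - 2))
    refine IsPath.false_of_arms_two_two_two (p := fun t => p (j - 2 + t)) (w := s) (x := x)
      ⟨fun a ha b hb => hd.inj a (by omega) b (by omega), fun t ht => hd.adj t (by omega)⟩ h
      (fun t ht => hw _ (by omega)) (fun t ht => hxp _ (by omega)) hxw ?_ hsx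
    rwa [show j - 2 + 2 = j by omega]
  -- A second branch on the path: the interior segment has the four outer neighbours `p 0`, `p (k -
  -- 1)`, `w` and `x`.
  · have hf' := hp.isFork_of_maximal hmax hxp hi hsx
    have h3 := hf'.one_le
    have h4 := hf'.add_two_le
    have a1 := hp.adj 0 (by omega)
    have a2 := hp.adj (k - 2) (by omega)
    rw [M.symmetric] at a1
    rw [show k - 2 + 1 = k - 1 by omega] at a2
    have hmem : ∀ t < k, p t ∈ IsPath.seg p 1 (k - 1) ↔ 1 ≤ t ∧ t < k - 1 := fun t ht =>
      hp.mem_seg (by omega) ht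
    refine h.false_of_four_adj (hp.isTight_seg h (a := 1) (b := k - 1) (by omega) (by omega))
      ((hmem _ (by omega)).2 (by omega)) ((hmem _ (by omega)).2 (by omega))
      ((hmem _ hj).2 (by omega)) ((hmem _ hi).2 (by omega))
      (fun hm => by have := (hmem _ (by omega)).1 hm; omega)
      (fun hm => by have := (hmem _ (by omega)).1 hm; omega)
      (IsPath.notMem_seg (k := k) (by omega) hw) (IsPath.notMem_seg (k := k) (by omega) hxp)
      ?_ a1 a2 hadj hsx
    have hne : p 0 ≠ p (k - 1) := fun e => by
      have := hp.inj _ (by omega) _ (by omega) e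
      omega
    simp [hne, hxw, hw 0 hk, hxp 0 hk, hw (k - 1) (by omega), hxp (k - 1) (by omega)]

/-! ### Identification of the diagrams -/

theorem iso_of_bijective {n : ℕ} {E : LabelledGraph (Fin n)} (h0 : ∀ i j, M i j ≠ 0) (f : Fin n → I)
    (hf : Function.Bijective f) (hadj : ∀ s t, E.graph.Adj s t ↔ 3 ≤ M (f s) (f t))
    (hlab : ∀ s t, E.label s t = if 4 ≤ M (f s) (f t) then some (M (f s) (f t)) else none) :
    (ofCoxeterMatrix M).Iso E := by
  refine ⟨(Equiv.ofBijective f hf).symm, fun i j => ?_, fun i j => ?_⟩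
  · obtain ⟨s, rfl⟩ := hf.2 i
    obtain ⟨t, rfl⟩ := hf.2 j
    rw [Equiv.ofBijective_symm_apply_apply, Equiv.ofBijective_symm_apply_apply, hadj]
    simp [ofCoxeterMatrix, h0]
  · obtain ⟨s, rfl⟩ := hf.2 i
    obtain ⟨t, rfl⟩ := hf.2 j
    rw [Equiv.ofBijective_symm_apply_apply, Equiv.ofBijective_symm_apply_apply, hlab]
    simp [ofCoxeterMatrix, h0]

theorem IsPath.iso_path (hp : IsPath M p k) (h : IsRealization B v M)
    (hcov : ∀ x, ∃ t < k, p t = x) (l : ℕ → Option ℕ)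
    (hl : ∀ t, t + 1 < k →
      l t = if 4 ≤ M (p t) (p (t + 1)) then some (M (p t) (p (t + 1))) else none) :
    (ofCoxeterMatrix M).Iso (path k l) := by
  classical
  have hfar : ∀ s < k, ∀ t < k, s + 1 ≠ t → t + 1 ≠ s → M (p s) (p t) < 3 := by
    intro s hs t ht h1 h2
    rcases lt_trichotomy s t with hlt | rfl | hlt
    · rw [hp.eq_two h (by omega) ht]; norm_num
    · simp
    · rw [M.symmetric, hp.eq_two h (by omega) hs]; norm_num
  refine iso_of_bijective h.label_ne_zero (fun t => p t)
    ⟨fun s t e => Fin.ext (hp.inj _ s.2 _ t.2 e), fun x => ?_⟩ (fun s t => ?_) (fun s t => ?_)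
  · obtain ⟨t, ht, e⟩ := hcov x
    exact ⟨⟨t, ht⟩, e⟩
  · constructor
    · rintro (e | e)
      · have := hp.adj s (by omega)
        rwa [e] at this
      · have := hp.adj t (by omega)
        rwa [e, M.symmetric] at this
    · intro h3
      by_contra hc
      rw [path, not_or] at hc
      have := hfar s s.2 t t.2 hc.1 hc.2
      omega
  · simp only [path]
    by_cases h1 : (s : ℕ) + 1 = t
    · rw [if_pos h1, hl s (by omega), h1]
    · rw [if_neg h1]
      by_cases h2 : (t : ℕ) + 1 = s
      · rw [if_pos h2, hl t (by omega), h2, M.symmetric]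
      · rw [if_neg h2, if_neg]
        have := hfar s s.2 t t.2 h1 h2
        omega

/-- Contracting the segment from the branch vertex to a heavy edge leaves a star with that edge and
two more, of total at least `2 + 1 + 1`. -/
theorem IsFork.lt_four {w : I} {j : ℕ} (hf : IsFork M p k w j) (h : IsRealization B v M) :
    M (p j) w < 4 ∧ ∀ t, t + 1 < k → M (p t) (p (t + 1)) < 4 := by
  classical
  have hp := hf.isPath
  have h1 := hf.one_le
  have h2 := hf.add_two_le
  have hne : ∀ s < k, ∀ t < k, s ≠ t → p s ≠ p t := fun s hs t ht hst e => hst (hp.inj s hs t ht e)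
  have hprev := hp.adj (j - 1) (by omega)
  rw [show j - 1 + 1 = j by omega, M.symmetric] at hprev
  have hnext := hp.adj j (by omega)
  constructor
  · by_contra! h4
    have hmem : ∀ t < k, p t ∈ IsPath.seg p j (j + 1) ↔ j ≤ t ∧ t < j + 1 := fun t ht =>
      hp.mem_seg (by omega) ht
    refine h.false_of_heavy_of_two_adj (hp.isTight_seg h (a := j) (b := j + 1) (by omega) (by omega))
      ((hmem j (by omega)).2 (by omega)) ((hmem j (by omega)).2 (by omega))
      ((hmem j (by omega)).2 (by omega)) (IsPath.notMem_seg (k := k) (by omega) hf.ne)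
      (fun hm => by have := (hmem _ (by omega)).1 hm; omega)
      (fun hm => by have := (hmem _ (by omega)).1 hm; omega) ?_ h4 hprev hnext
    simp [(hf.ne (j - 1) (by omega)).symm, (hf.ne (j + 1) (by omega)).symm,
      hne (j - 1) (by omega) (j + 1) (by omega) (by omega)]
  · intro i hi
    by_contra! h4
    rcases lt_or_ge i j with hij | hij
    · have hmem : ∀ t < k, p t ∈ IsPath.seg p (i + 1) (j + 1) ↔ i + 1 ≤ t ∧ t < j + 1 := fun t ht =>
        hp.mem_seg (by omega) ht
      rw [M.symmetric] at h4
      refine h.false_of_heavy_of_two_adj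
        (hp.isTight_seg h (a := i + 1) (b := j + 1) (by omega) (by omega))
        ((hmem (i + 1) (by omega)).2 (by omega)) ((hmem j (by omega)).2 (by omega))
        ((hmem j (by omega)).2 (by omega))
        (fun hm => by have := (hmem _ (by omega)).1 hm; omega)
        (IsPath.notMem_seg (k := k) (by omega) hf.ne)
        (fun hm => by have := (hmem _ (by omega)).1 hm; omega) ?_ h4 hf.adj hnext
      simp [hf.ne i (by omega), (hf.ne (j + 1) (by omega)).symm,
        hne i (by omega) (j + 1) (by omega) (by omega)]
    · have hmem : ∀ t < k, p t ∈ IsPath.seg p j (i + 1) ↔ j ≤ t ∧ t < i + 1 := fun t ht =>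
        hp.mem_seg (by omega) ht
      refine h.false_of_heavy_of_two_adj
        (hp.isTight_seg h (a := j) (b := i + 1) (by omega) (by omega))
        ((hmem i (by omega)).2 (by omega)) ((hmem j (by omega)).2 (by omega))
        ((hmem j (by omega)).2 (by omega))
        (fun hm => by have := (hmem _ (by omega)).1 hm; omega)
        (IsPath.notMem_seg (k := k) (by omega) hf.ne)
        (fun hm => by have := (hmem _ (by omega)).1 hm; omega) ?_ h4 hf.adj hprev
      simp [hf.ne (i + 1) (by omega), (hf.ne (j - 1) (by omega)).symm,
        hne (i + 1) (by omega) (j - 1) (by omega) (by omega)]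

theorem IsFork.iso_fork {w : I} {j : ℕ} (hf : IsFork M p k w j) (h : IsRealization B v M)
    (hcov : ∀ x, x = w ∨ ∃ t < k, p t = x) : (ofCoxeterMatrix M).Iso (fork (k + 1) j) := by
  classical
  have hp := hf.isPath
  have hj := hf.add_two_le
  obtain ⟨hlw, hlp⟩ := hf.lt_four h
  have hw : ∀ t < k, t ≠ j → M (p t) w = 2 := by
    intro t ht htj
    by_contra hne
    have h3 := h.three_le_of_ne_two (hf.ne t ht) hne
    exact htj (hp.inj t ht j (by omega) (h.eq_of_adj_of_adj
      (hp.isTight_seg h (a := 0) (b := k) (by omega) le_rfl)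
      ((hp.mem_seg le_rfl ht).2 (by omega)) ((hp.mem_seg le_rfl (by omega)).2 (by omega))
      (IsPath.notMem_seg (k := k) le_rfl hf.ne) h3 hf.adj))
  set f : Fin (k + 1) → I := fun t => if (t : ℕ) = k then w else p t with hfdef
  have key : ∀ s t : Fin (k + 1), (s : ℕ) < t →
      M (f s) (f t) < 4 ∧ ((fork (k + 1) j).graph.Adj s t ↔ 3 ≤ M (f s) (f t)) := by
    intro s t hst
    have hsk : (s : ℕ) ≠ k := by omega
    have hne : s ≠ t := fun e => by rw [e] at hst; omega
    simp only [hfdef, hsk, if_false, fork, SimpleGraph.fromRel_adj, ne_eq, hne, not_false_eq_true,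
      true_and]
    by_cases htk : (t : ℕ) = k
    · rw [if_pos htk]
      by_cases hsj : (s : ℕ) = j
      · rw [hsj]
        have := hf.adj
        exact ⟨hlw, by omega⟩
      · rw [hw s (by omega) hsj]
        exact ⟨by norm_num, by omega⟩
    · rw [if_neg htk]
      by_cases hs1 : (s : ℕ) + 1 = t
      · rw [← hs1]
        have := hp.adj s (by omega)
        exact ⟨hlp s (by omega), by omega⟩
      · rw [hp.eq_two h (by omega) (by omega)]
        exact ⟨by norm_num, by omega⟩
  refine iso_of_bijective h.label_ne_zero f ⟨fun s t e => ?_, fun x => ?_⟩ (fun s t => ?_)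
    (fun s t => ?_)
  · exact Fin.ext (inj_append hp.inj hf.ne s (by omega) t (by omega) e)
  · rcases hcov x with rfl | ⟨t, ht, rfl⟩
    · exact ⟨⟨k, by omega⟩, by simp [hfdef]⟩
    · exact ⟨⟨t, by omega⟩, by simp [hfdef, ht.ne]⟩
  · rcases lt_trichotomy s t with hlt | rfl | hlt
    · exact (key s t hlt).2
    · simp
    · rw [SimpleGraph.adj_comm, M.symmetric]
      exact (key t s hlt).2
  · have : M (f s) (f t) < 4 := by
      rcases lt_trichotomy s t with hlt | rfl | hlt
      · exact (key s t hlt).1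
      · simp
      · rw [M.symmetric]
        exact (key t s hlt).1
    rw [if_neg (by omega)]
    rfl

theorem IsFork.isIrreducibleFiniteType {w : I} {j : ℕ} (hf : IsFork M p k w j)
    (h : IsRealization B v M) (hcov : ∀ x, x = w ∨ ∃ t < k, p t = x) :
    (ofCoxeterMatrix M).IsIrreducibleFiniteType := by
  -- The arms along the path have lengths `j` and `k - 1 - j`; reversal makes the first the shorter.
  wlog hjk : 2 * j + 1 ≤ k generalizing p j
  · have hj := hf.add_two_le
    refine this hf.reverse (fun x => (hcov x).imp id ?_) (by omega)
    rintro ⟨t, ht, rfl⟩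
    exact ⟨k - 1 - t, by omega, by rw [show k - 1 - (k - 1 - t) = t by omega]⟩
  have h1 := hf.one_le
  have h2 := hf.add_two_le
  have hp := hf.isPath
  obtain rfl | rfl | hj3 : j = 1 ∨ j = 2 ∨ 3 ≤ j := by omega
  · refine Or.inr (Or.inr (Or.inl ⟨k + 1, by omega, ?_⟩))
    -- `typeD` branches near the far end of its path, hence the reversal.
    have := hf.reverse.iso_fork h (fun x => (hcov x).imp id (by
      rintro ⟨t, ht, rfl⟩
      exact ⟨k - 1 - t, by omega, by rw [show k - 1 - (k - 1 - t) = t by omega]⟩))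
    rwa [typeD, show k + 1 - 3 = k - 1 - 1 by omega]
  · have hiso := hf.iso_fork h hcov
    have hk : k < 8 := by
      by_contra! hk
      exact IsPath.false_of_arms_two_five (p := p)
        ⟨fun a ha b hb => hp.inj a (by omega) b (by omega), fun t ht => hp.adj t (by omega)⟩ h
        (fun t ht => hf.ne t (by omega)) hf.adj
    obtain rfl | rfl | rfl : k = 5 ∨ k = 6 ∨ k = 7 := by omega
    · exact Or.inr (Or.inr (Or.inr (Or.inl hiso)))
    · exact Or.inr (Or.inr (Or.inr (Or.inr (Or.inl hiso))))
    · exact Or.inr (Or.inr (Or.inr (Or.inr (Or.inr (Or.inl hiso)))))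
  · have hd := hp.drop (j - 3)
    refine (IsPath.false_of_arms_three_three (p := fun t => p (j - 3 + t)) (w := w)
      ⟨fun a ha b hb => hd.inj a (by omega) b (by omega), fun t ht => hd.adj t (by omega)⟩ h
      (fun t ht => hf.ne _ (by omega)) ?_).elim
    have := hf.adj
    rwa [show j - 3 + 3 = j by omega]

/-- Contracting the segment between two heavy edges leaves a star of total at least `2 + 2`. -/
theorem IsPath.lt_four_of_ne (hp : IsPath M p k) (h : IsRealization B v M) {i j : ℕ}
    (hi : i + 1 < k) (h4 : 4 ≤ M (p i) (p (i + 1))) (hj : j + 1 < k) (hij : j ≠ i) :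
    M (p j) (p (j + 1)) < 4 := by
  classical
  have key : ∀ i j, i + 1 < k → 4 ≤ M (p i) (p (i + 1)) → j + 1 < k →
      4 ≤ M (p j) (p (j + 1)) → i < j → False := by
    intro i j hi h4 hj h4' hij
    have hmem : ∀ t < k, p t ∈ IsPath.seg p (i + 1) (j + 1) ↔ i + 1 ≤ t ∧ t < j + 1 := fun t ht =>
      hp.mem_seg (by omega) ht
    rw [M.symmetric] at h4
    refine h.false_of_two_adj (hp.isTight_seg h (a := i + 1) (b := j + 1) (by omega) (by omega))
      ((hmem (i + 1) (by omega)).2 (by omega)) ((hmem j (by omega)).2 (by omega))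
      (j₁ := p i) (j₂ := p (j + 1))
      (fun hm => by have := (hmem _ (by omega)).1 hm; omega)
      (fun hm => by have := (hmem _ (by omega)).1 hm; omega)
      (fun e => by have := hp.inj _ (by omega) _ (by omega) e; omega) ?_
    linarith [h.sq_of_four_le _ _ h4, h.sq_of_four_le _ _ h4']
  by_contra! h4'
  rcases lt_or_gt_of_ne hij with hlt | hlt
  · exact key j i hj h4' hi h4 hlt
  · exact key i j hi h4 hj h4' hlt

/-- Such an edge and a neighbouring one form a star of total at least `3 + 1`. -/
theorem IsPath.lt_six (hp : IsPath M p k) (h : IsRealization B v M) {i : ℕ}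
    (hk : 3 ≤ k) (hi : i + 1 < k) : M (p i) (p (i + 1)) < 6 := by
  classical
  by_contra! h6
  rcases Nat.eq_zero_or_pos i with rfl | hi0
  · have hmem : ∀ t < k, p t ∈ IsPath.seg p 1 2 ↔ 1 ≤ t ∧ t < 2 := fun t ht =>
      hp.mem_seg (by omega) ht
    rw [M.symmetric] at h6
    refine h.false_of_two_adj (hp.isTight_seg h (a := 1) (b := 2) (by omega) (by omega))
      ((hmem 1 (by omega)).2 (by omega)) ((hmem 1 (by omega)).2 (by omega))
      (j₁ := p 0) (j₂ := p 2)
      (fun hm => by have := (hmem _ (by omega)).1 hm; omega)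
      (fun hm => by have := (hmem _ (by omega)).1 hm; omega)
      (fun e => by have := hp.inj _ (by omega) _ (by omega) e; omega) ?_
    linarith [h.sq_of_six_le _ _ h6, h.one_le_sq (hp.adj 1 (by omega))]
  · have hmem : ∀ t < k, p t ∈ IsPath.seg p i (i + 1) ↔ i ≤ t ∧ t < i + 1 := fun t ht =>
      hp.mem_seg (by omega) ht
    have hprev := hp.adj (i - 1) (by omega)
    rw [show i - 1 + 1 = i by omega, M.symmetric] at hprev
    refine h.false_of_two_adj (hp.isTight_seg h (a := i) (b := i + 1) (by omega) (by omega))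
      ((hmem i (by omega)).2 (by omega)) ((hmem i (by omega)).2 (by omega))
      (j₁ := p (i + 1)) (j₂ := p (i - 1))
      (fun hm => by have := (hmem _ (by omega)).1 hm; omega)
      (fun hm => by have := (hmem _ (by omega)).1 hm; omega)
      (fun e => by have := hp.inj _ (by omega) _ (by omega) e; omega) ?_
    linarith [h.sq_of_six_le _ _ h6, h.one_le_sq hprev]

theorem IsPath.iso_path_of_four_le (hp : IsPath M p k) (h : IsRealization B v M)
    (hcov : ∀ x, ∃ t < k, p t = x) {i : ℕ} (hi : i + 1 < k) (h4 : 4 ≤ M (p i) (p (i + 1)))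
    (l : ℕ → Option ℕ) (hl : l i = some (M (p i) (p (i + 1))))
    (hl' : ∀ t, t + 1 < k → t ≠ i → l t = none) : (ofCoxeterMatrix M).Iso (path k l) := by
  refine hp.iso_path h hcov l fun t ht => ?_
  by_cases hti : t = i
  · rw [hti, hl, if_pos h4]
  · have := hp.lt_four_of_ne h hi h4 ht hti
    rw [hl' t ht hti, if_neg (by omega)]

theorem IsPath.isIrreducibleFiniteType (hp : IsPath M p k) (h : IsRealization B v M) (hk : 0 < k)
    (hcov : ∀ x, ∃ t < k, p t = x) : (ofCoxeterMatrix M).IsIrreducibleFiniteType := by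
  by_cases hlight : ∀ t, t + 1 < k → M (p t) (p (t + 1)) < 4
  · refine Or.inl ⟨k, hk, hp.iso_path h hcov _ fun t ht => ?_⟩
    have := hlight t ht
    rw [if_neg (by omega)]
  push Not at hlight
  obtain ⟨i, hi, h4⟩ := hlight
  -- Reversal puts the heavy edge in the second half; its index in the reversed path is `k - 2 - i`.
  wlog hik : k ≤ 2 * i + 2 generalizing p i
  · refine this hp.reverse (fun x => ?_) (k - 2 - i) (by omega) ?_ (by omega)
    · obtain ⟨t, ht, rfl⟩ := hcov x
      exact ⟨k - 1 - t, by omega, by rw [show k - 1 - (k - 1 - t) = t by omega]⟩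
    · rw [M.symmetric, show k - 1 - (k - 2 - i + 1) = i by omega,
        show k - 1 - (k - 2 - i) = i + 1 by omega]
      exact h4
  have hrev := hp.reverse
  have hcov' : ∀ x, ∃ t < k, p (k - 1 - t) = x := fun x => by
    obtain ⟨t, ht, rfl⟩ := hcov x
    exact ⟨k - 1 - t, by omega, by rw [show k - 1 - (k - 1 - t) = t by omega]⟩
  have hrevlab : M (p (k - 1 - (k - 2 - i))) (p (k - 1 - (k - 2 - i + 1))) =
      M (p i) (p (i + 1)) := by
    rw [M.symmetric, show k - 1 - (k - 2 - i + 1) = i by omega,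
      show k - 1 - (k - 2 - i) = i + 1 by omega]
  rcases Nat.lt_or_ge k 3 with hk3 | hk3
  · obtain rfl : k = 2 := by omega
    obtain rfl : i = 0 := by omega
    rcases Nat.lt_or_ge (M (p 0) (p (0 + 1))) 5 with h5 | h5
    · refine Or.inr (Or.inl ⟨2, le_rfl, hp.iso_path_of_four_le h hcov hi h4 _ ?_ (by omega)⟩)
      rw [if_pos rfl, show M (p 0) (p (0 + 1)) = 4 by omega]
    · exact Or.inr (Or.inr (Or.inr (Or.inr (Or.inr (Or.inr (Or.inr (Or.inr (Or.inr
        ⟨_, h5, hp.iso_path_of_four_le h hcov hi h4 _ rfl (by omega)⟩))))))))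
  have h6 := hp.lt_six h hk3 hi
  obtain h4 | h5 : M (p i) (p (i + 1)) = 4 ∨ M (p i) (p (i + 1)) = 5 := by omega
  · by_cases hend : i + 2 = k
    · refine Or.inr (Or.inl ⟨k, by omega, hp.iso_path_of_four_le h hcov hi h4.ge _ ?_ ?_⟩)
      · rw [if_pos hend, h4]
      · exact fun t _ hti => if_neg (by omega)
    · rcases Nat.lt_or_ge k 5 with hk5 | hk5
      · obtain rfl : k = 4 := by omega
        obtain rfl : i = 1 := by omega
        refine Or.inr (Or.inr (Or.inr (Or.inr (Or.inr (Or.inr (Or.inl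
          (hp.iso_path_of_four_le h hcov hi h4.ge _ ?_ ?_)))))))
        · simp [h4]
        · exact fun t _ hti => if_neg hti
      -- Read backwards from one vertex before the heavy edge, the path has at least five vertices
      -- and the heavy edge comes second.
      · have hd := hrev.drop (k - 2 - i - 1)
        refine (IsPath.false_of_four_second (p := fun t => p (k - 1 - (k - 2 - i - 1 + t)))
          ⟨fun a ha b hb => hd.inj a (by omega) b (by omega), fun t ht => hd.adj t (by omega)⟩ h
          ?_).elim
        rw [show k - 2 - i - 1 + 1 = k - 2 - i by omega,
          show k - 2 - i - 1 + 2 = k - 2 - i + 1 by omega, hrevlab, h4]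
  · by_cases hend : i + 2 = k
    · obtain rfl : i = k - 2 := by omega
      rw [show k - 2 - (k - 2) = 0 by omega] at hrevlab
      have hk5 : k < 5 := by
        by_contra! hk5
        refine IsPath.false_of_five_first (p := fun t => p (k - 1 - t))
          ⟨fun a ha b hb => hrev.inj a (by omega) b (by omega),
            fun t ht => hrev.adj t (by omega)⟩ h ?_
        exact (hrevlab.trans h5).ge
      have hiso : (ofCoxeterMatrix M).Iso (typeH k) := by
        refine hrev.iso_path_of_four_le h hcov' (i := 0) (by omega) ?_ _ ?_ ?_
        · rw [hrevlab]; omega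
        · rw [hrevlab, h5]; rfl
        · exact fun t _ hti => if_neg hti
      obtain rfl | rfl : k = 3 ∨ k = 4 := by omega
      · exact Or.inr (Or.inr (Or.inr (Or.inr (Or.inr (Or.inr (Or.inr (Or.inl hiso)))))))
      · exact Or.inr (Or.inr (Or.inr (Or.inr (Or.inr (Or.inr (Or.inr (Or.inr (Or.inl hiso))))))))
    · have hd := hp.drop (i - 1)
      refine (IsPath.false_of_five_middle (p := fun t => p (i - 1 + t))
        ⟨fun a ha b hb => hd.inj a (by omega) b (by omega), fun t ht => hd.adj t (by omega)⟩ h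
        ?_).elim
      rw [show i - 1 + 1 = i by omega, show i - 1 + 2 = i + 1 by omega, h5]

theorem IsRealization.isIrreducibleFiniteType [Fintype I] [Nonempty I] (h : IsRealization B v M) :
    (ofCoxeterMatrix M).IsIrreducibleFiniteType := by
  rcases h.exists_path_or_fork with ⟨p, k, hk, hp, hcov⟩ | ⟨p, k, w, j, hf, hcov⟩
  · exact hp.isIrreducibleFiniteType h hk hcov
  · exact hf.isIrreducibleFiniteType h hcov

end CoxeterForm

/-! ### From cosines to Coxeter labels. -/

namespace ReflectionSystem

open Module

section

variable {F V : Type*} [Field F] [LinearOrder F] [IsStrictOrderedRing F]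
  [AddCommGroup V] [Module F V] {B : LinearMap.BilinForm F V} {Φ : Set V}
  {I : Type*} {b : Basis I F V}

theorem IsSimpleBasis.exists_coxeterMatrix (h : IsReflectionStable B Φ) (hb : IsSimpleBasis Φ b)
    (ι : F →+* ℝ) (hι : StrictMono ι) :
    ∃ M : CoxeterMatrix I, ∀ i j (m : ℕ),
      (0 < m ∧ ι (B (b i) (b j)) = -2 * Real.cos (Real.pi / m)) ↔ m = M i j := by
  have hself : ∀ i, ι (B (b i) (b i)) = -2 * Real.cos (Real.pi / (1 : ℕ)) := fun i => by
    rw [h.norm _ (hb.mem i), map_ofNat]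
    simp
  have hex : ∀ i j, ∃ m : ℕ, 0 < m ∧ ι (B (b i) (b j)) = -2 * Real.cos (Real.pi / m) := by
    intro i j
    by_cases hij : i = j
    · exact ⟨1, one_pos, hij ▸ hself i⟩
    · obtain ⟨m, hm, e⟩ := hb.exists_label h ι hι hij
      exact ⟨m, by omega, e⟩
  choose N hN0 hN using hex
  have huniq : ∀ i j (m : ℕ), 0 < m → ι (B (b i) (b j)) = -2 * Real.cos (Real.pi / m) → m = N i j := by
    intro i j m hm e
    rw [hN i j] at e
    exact (cos_pi_div_injective (hN0 i j) hm (by linarith)).symm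
  refine ⟨⟨N, ?_, fun i => (huniq i i 1 one_pos (hself i)).symm, fun i j hij h1 => ?_⟩,
    fun i j m => ⟨fun hm => huniq i j m hm.1 hm.2, ?_⟩⟩
  · ext i j
    exact huniq i j _ (hN0 j i) (by rw [h.symm]; exact hN j i)
  · have e := hN i j
    -- A label `1` off the diagonal would mean the product `2`.
    have hle : ι (B (b i) (b j)) ≤ 0 := by
      simpa using hι.monotone (IsSimpleBasis.apply_nonpos h hb hij)
    rw [h1] at e
    simp at e
    linarith
  · rintro rfl
    exact ⟨hN0 i j, hN i j⟩

theorem apply_eq_zero_of_label_eq_two {ι : F →+* ℝ} {x y : V} {m : ℕ}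
    (e : ι (B x y) = -2 * Real.cos (Real.pi / m)) (hm : m = 2) : B x y = 0 := by
  apply ι.injective
  rw [e, hm]
  simp

theorem apply_le_of_three_le {ι : F →+* ℝ} (hι : StrictMono ι) {x y : V} {m : ℕ}
    (e : ι (B x y) = -2 * Real.cos (Real.pi / m)) (hm : 3 ≤ m) : B x y ≤ -1 := by
  have := cos_pi_div_le_cos_pi_div (by norm_num) hm
  rw [Nat.cast_ofNat, Real.cos_pi_div_three] at this
  rw [← hι.le_iff_le, e, map_neg, map_one]
  linarith

theorem apply_le_of_five_le {ι : F →+* ℝ} (hι : StrictMono ι) {x y : V} {m : ℕ}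
    (e : ι (B x y) = -2 * Real.cos (Real.pi / m)) (hm : 5 ≤ m) : B x y ≤ -(8 / 5) := by
  have := cos_pi_div_le_cos_pi_div (by norm_num) hm
  rw [Nat.cast_ofNat, Real.cos_pi_div_five] at this
  have h5 : (2.2 : ℝ) ≤ √5 := Real.le_sqrt_of_sq_le (by norm_num)
  rw [← hι.le_iff_le, e, map_neg, map_div₀, map_ofNat, map_ofNat]
  linarith

theorem le_apply_sq_of_four_le {ι : F →+* ℝ} (hι : StrictMono ι) {x y : V} {m : ℕ}
    (e : ι (B x y) = -2 * Real.cos (Real.pi / m)) (hm : 4 ≤ m) : 2 ≤ B x y ^ 2 := by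
  have := cos_pi_div_le_cos_pi_div (by norm_num) hm
  rw [Nat.cast_ofNat, Real.cos_pi_div_four] at this
  rw [← hι.le_iff_le, map_pow, e, map_ofNat]
  nlinarith [Real.sq_sqrt (show (0 : ℝ) ≤ 2 by norm_num), Real.sqrt_nonneg 2]

theorem le_apply_sq_of_six_le {ι : F →+* ℝ} (hι : StrictMono ι) {x y : V} {m : ℕ}
    (e : ι (B x y) = -2 * Real.cos (Real.pi / m)) (hm : 6 ≤ m) : 3 ≤ B x y ^ 2 := by
  have := cos_pi_div_le_cos_pi_div (by norm_num) hm
  rw [Nat.cast_ofNat, Real.cos_pi_div_six] at this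
  rw [← hι.le_iff_le, map_pow, e, map_ofNat]
  nlinarith [Real.sq_sqrt (show (0 : ℝ) ≤ 3 by norm_num), Real.sqrt_nonneg 3]

end

end ReflectionSystem

/-! ### Root lattices and their fundamental systems. -/

namespace RootLattice

open Module ReflectionSystem

section

variable {K : Type*} [Field K] {V : Type*} [AddCommGroup V] [Module K V]
  [Module (𝓞 K) V]

theorem isLatticeIn_span_image {I : Type*} [Finite I] {v : I → V}
    (hv : LinearIndependent K v) (S : Set I) :
    IsLatticeIn (Submodule.span K (v '' S)) (Submodule.span (𝓞 K) (v '' S)) := by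
  let e := Finite.equivFin S
  have hr : Set.range (fun t => v (e.symm t)) = v '' S := by
    rw [Set.image_eq_range]
    exact e.symm.surjective.range_comp (fun i : S => v i)
  refine ⟨Nat.card S, fun t => v (e.symm t), ?_, by rw [hr], by rw [hr]⟩
  exact hv.comp (fun t => (e.symm t : I)) (Subtype.val_injective.comp e.symm.injective)

/-- `b` is a basis of `L` over `𝓞 K` as well, so an orthogonal partition of it splits `V` and `L`
together. -/
theorem isReducible_of_orthogonal {B : LinearMap.BilinForm K V} {L : Submodule (𝓞 K) V}
    {I : Type*} [Finite I] (b : Basis I K V) (hL : Submodule.span (𝓞 K) (Set.range b) = L)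
    {S : Set I} (hS : S.Nonempty) (hS' : ∃ j, j ∉ S)
    (horth : ∀ i ∈ S, ∀ j, j ∉ S → B (b i) (b j) = 0) : IsReducible B L := by
  have hbot : ∀ T : Set I, T.Nonempty → Submodule.span K (b '' T) ≠ ⊥ := by
    rintro T ⟨i, hi⟩ h0
    have : b i ∈ Submodule.span K (b '' T) := Submodule.subset_span ⟨i, hi, rfl⟩
    rw [h0, Submodule.mem_bot] at this
    exact b.ne_zero i this
  refine ⟨Submodule.span K (b '' S), Submodule.span K (b '' Sᶜ), hbot S hS, hbot _ hS',
    ⟨b.linearIndependent.disjoint_span_image disjoint_compl_right, ?_⟩, ?_,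
    Submodule.span (𝓞 K) (b '' S), Submodule.span (𝓞 K) (b '' Sᶜ),
    isLatticeIn_span_image b.linearIndependent S, isLatticeIn_span_image b.linearIndependent Sᶜ, ?_⟩
  · rw [codisjoint_iff, ← Submodule.span_union, ← Set.image_union, Set.union_compl_self,
      Set.image_univ, b.span_eq]
  · intro x hx y hy
    induction hx, hy using Submodule.span_induction₂ with
    | mem_mem x y hx hy =>
      obtain ⟨i, hi, rfl⟩ := hx
      obtain ⟨j, hj, rfl⟩ := hy
      exact horth i hi j hj
    | zero_left => simp
    | zero_right => simp
    | add_left _ _ _ _ _ _ h1 h2 => simp [h1, h2]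
    | add_right _ _ _ _ _ _ h1 h2 => simp [h1, h2]
    | smul_left _ _ _ _ _ h => simp [h]
    | smul_right _ _ _ _ _ h => simp [h]
  · rw [← Submodule.span_union, ← Set.image_union, Set.union_compl_self, Set.image_univ, hL]

variable [IsScalarTower (𝓞 K) K V]

theorem coe_smul (a : 𝓞 K) (x : V) : (a : K) • x = a • x :=
  IsScalarTower.algebraMap_smul K a x

theorem IsRootLattice.span_roots {B : LinearMap.BilinForm K V} {L : Submodule (𝓞 K) V}
    (hL : IsRootLattice B L) : Submodule.span K (roots B L) = ⊤ := by
  obtain ⟨n, v, -, hV, hvL⟩ := hL.lattice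
  rw [eq_top_iff, ← hV, Submodule.span_le]
  rintro _ ⟨i, rfl⟩
  have : v i ∈ Submodule.span (𝓞 K) (roots B L) := by
    rw [hL.generated, ← hvL]
    exact Submodule.subset_span ⟨i, rfl⟩
  exact Submodule.span_subset_span (𝓞 K) K _ this

theorem IsRootLattice.isReflectionStable [LinearOrder K] [IsStrictOrderedRing K]
    {B : LinearMap.BilinForm K V} {L : Submodule (𝓞 K) V} (hL : IsRootLattice B L)
    (hsymm : B.IsSymm) (hpos : ∀ x, x ≠ 0 → 0 < B x x) (hfin : (roots B L).Finite) :
    IsReflectionStable B (roots B L) where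
  symm x y := hsymm.eq x y
  pos := hpos
  finite := hfin
  norm x hx := hx.2
  reflect x hx y hy := by
    have hs : B y x = B x y := hsymm.eq y x
    refine ⟨?_, ?_⟩
    · obtain ⟨a, ha⟩ := hL.integral x hx.1 y hy.1
      rw [← ha, coe_smul]
      exact L.sub_mem hy.1 (L.smul_mem a hx.1)
    · simp only [map_sub, LinearMap.sub_apply, map_smul, LinearMap.smul_apply, smul_eq_mul, hx.2,
        hy.2, hs]
      ring

theorem exists_coeff [LinearOrder K] [IsStrictOrderedRing K] {ι : K →+* ℝ} (hι : StrictMono ι)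
    {B : LinearMap.BilinForm K V} {L : Submodule (𝓞 K) V} (hL : IsRootLattice B L)
    (h : IsReflectionStable B (roots B L)) {I : Type*} [Fintype I] {b : Basis I K V}
    (hb : IsSimpleBasis (roots B L) b) {γ : V} (hγ : γ ∈ roots B L)
    (hγ0 : ∀ i, 0 ≤ b.repr γ i) :
    ∃ c : I → 𝓞 K, γ = ∑ i, c i • b i ∧ ∀ i, c i = 0 ∨ 1 ≤ ι (c i : K) := by
  -- The gap comes from the labels: `2 cos (π / m)` is `0` for `m = 2` and at least `1` for `m ≥ 3`.
  have key := hb.repr_mem h (algebraMap (𝓞 K) K).range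
    (fun x hx y hy => hL.integral x hx.1 y hy.1) (fun i j hij => by
      obtain ⟨m, hm, e⟩ := hb.exists_label h ι hι hij
      rcases hm.eq_or_lt with h2 | h2
      · exact Or.inl (apply_eq_zero_of_label_eq_two e h2.symm)
      · exact Or.inr (apply_le_of_three_le hι e h2)) hγ hγ0
  choose c hc using fun i => (key i).1
  refine ⟨c, ?_, fun i => ?_⟩
  · conv_lhs => rw [← b.sum_repr γ]
    refine Finset.sum_congr rfl fun i _ => ?_
    rw [← hc, coe_smul]
  · rcases (key i).2 with h0 | h1
    · left
      rw [← hc] at h0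
      exact (map_eq_zero_iff _ (RingOfIntegers.coe_injective)).1 h0
    · right
      rw [← hc] at h1
      simpa using hι.monotone h1

theorem exists_isFundamentalSystem [LinearOrder K] [IsStrictOrderedRing K] [FiniteDimensional K V]
    {ι : K →+* ℝ} (hι : StrictMono ι)
    {B : LinearMap.BilinForm K V} {L : Submodule (𝓞 K) V} (hL : IsRootLattice B L)
    (h : IsReflectionStable B (roots B L)) : ∃ Δ, IsFundamentalSystem ι B L Δ := by
  obtain ⟨Δ, b, hbΔ, hb⟩ := h.exists_isSimpleBasis hL.span_roots
  have : Fintype Δ := FiniteDimensional.fintypeBasisIndex b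
  have hbΔ' : (b : Δ → V) = (↑) := funext hbΔ
  refine ⟨Δ, fun x hx => by simpa only [hbΔ] using hb.mem ⟨x, hx⟩, hbΔ' ▸ b.linearIndependent, ?_, ?_⟩
  · have := b.span_eq
    rwa [hbΔ', Subtype.range_coe] at this
  · intro γ hγ
    rcases hb.sign γ hγ with h0 | h0
    · obtain ⟨c, hc, hc1⟩ := exists_coeff hι hL h hb hγ h0
      refine ⟨Finsupp.equivFunOnFinite.symm c, ?_, Or.inl hc1⟩
      rw [Finsupp.sum_fintype _ _ (by simp), hc]
      simp [hbΔ]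
    · obtain ⟨c, hc, hc1⟩ := exists_coeff hι hL h hb (h.neg_mem hγ) (by simpa using h0)
      refine ⟨Finsupp.equivFunOnFinite.symm (-c), ?_, Or.inr fun i => ?_⟩
      · rw [Finsupp.sum_fintype _ _ (by simp), ← neg_neg γ, hc]
        simp [hbΔ]
      · simpa using hc1 i

/-- A fundamental system of roots, as a basis. -/
theorem IsFundamentalSystem.exists_basis [LinearOrder K] [IsStrictOrderedRing K]
    [FiniteDimensional K V] {ι : K →+* ℝ} (hι : StrictMono ι)
    {B : LinearMap.BilinForm K V} {L : Submodule (𝓞 K) V} (hL : IsRootLattice B L) {Δ : Set V}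
    (hΔ : IsFundamentalSystem ι B L Δ) :
    ∃ b : Basis Δ K V, (∀ i, b i = i) ∧ IsSimpleBasis (roots B L) b ∧
      Submodule.span (𝓞 K) (Set.range b) = L := by
  set b : Basis Δ K V := Basis.mk hΔ.linearIndependent
    (by rw [Subtype.range_coe, hΔ.span_eq_top]) with hbdef
  have hb : ∀ i, b i = i := fun i => by simp [hbdef]
  refine ⟨b, hb, ⟨fun i => hb i ▸ hΔ.subset_roots i.2, fun γ hγ => ?_⟩, le_antisymm ?_ ?_⟩
  · obtain ⟨c, hc, hc1⟩ := hΔ.decomp γ hγ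
    have hrepr : ∀ i, b.repr γ i = c i := by
      have : Fintype Δ := FiniteDimensional.fintypeBasisIndex b
      intro i
      have e : γ = ∑ j, (c j : K) • b j := by
        rw [hc, Finsupp.sum_fintype _ _ (by simp)]
        exact Finset.sum_congr rfl fun j _ => by rw [coe_smul, hb]
      rw [e, b.repr_sum_self]
    refine hc1.imp (fun h1 i => ?_) (fun h1 i => ?_)
    · rw [hrepr]
      rcases h1 i with h2 | h2
      · rw [h2]; simp
      · rw [← hι.le_iff_le, map_zero]; linarith
    · rw [hrepr]
      rcases h1 i with h2 | h2
      · rw [h2]; simp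
      · rw [← hι.le_iff_le, map_zero]
        rw [map_neg] at h2
        linarith
  · rw [Submodule.span_le]
    rintro _ ⟨i, rfl⟩
    exact hb i ▸ (hΔ.subset_roots i.2).1
  · rw [← hL.generated, Submodule.span_le]
    intro γ hγ
    obtain ⟨c, hc, -⟩ := hΔ.decomp γ hγ
    rw [hc]
    refine Submodule.sum_mem _ fun i _ => Submodule.smul_mem _ _ (Submodule.subset_span ⟨i, hb i⟩)

end

end RootLattice

theorem mainTheorem4 {K : Type*} [Field K] [CharZero K] [Algebra.IsAlgebraic ℚ K]
    [NumberField.IsTotallyReal K] (ι : K →+* ℝ)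
    {V : Type*} [AddCommGroup V] [Module K V] [FiniteDimensional K V] [Nontrivial V]
    [Module (𝓞 K) V] [IsScalarTower (𝓞 K) K V]
    (B : LinearMap.BilinForm K V) (hsymm : B.IsSymm) (hpos : RootLattice.IsTotallyPosDef B)
    (L : Submodule (𝓞 K) V) (hL : RootLattice.IsRootLattice B L)
    (hirr : ¬ RootLattice.IsReducible B L) (hfin : (RootLattice.roots B L).Finite) :
    (∃ Δ : Set V, RootLattice.IsFundamentalSystem ι B L Δ) ∧
    ∀ Δ : Set V, RootLattice.IsFundamentalSystem ι B L Δ →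
      ∃ M : CoxeterMatrix Δ,
        (∀ (α β : Δ) (m : ℕ), RootLattice.IsCoxeterLabel ι B α β m ↔ m = M α β) ∧
        (LabelledGraph.ofCoxeterMatrix M).IsIrreducibleFiniteType := by
  -- The order is pulled back along `ι`, so `ι` is strictly monotone by definition.
  let _ : LinearOrder K := LinearOrder.lift' ι ι.injective
  have hι : StrictMono ι := fun _ _ h => h
  have : IsStrictOrderedRing K := Function.Injective.isStrictOrderedRing ι (map_zero ι) (map_one ι)
    (map_add ι) (map_mul ι) (fun {_ _} => Iff.rfl) (fun {_ _} => Iff.rfl)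
  have h := hL.isReflectionStable hsymm
    (fun x hx => by rw [← hι.lt_iff_lt, map_zero]; exact hpos ι x hx) hfin
  refine ⟨RootLattice.exists_isFundamentalSystem hι hL h, fun Δ hΔ => ?_⟩
  obtain ⟨b, hbΔ, hb, hbL⟩ := hΔ.exists_basis hι hL
  have : Fintype Δ := FiniteDimensional.fintypeBasisIndex b
  have : Nonempty Δ := b.index_nonempty
  obtain ⟨M, hM⟩ := hb.exists_coxeterMatrix h ι hι
  have hM' : ∀ i j, 0 < M i j ∧ ι (B (b i) (b j)) = -2 * Real.cos (Real.pi / M i j) :=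
    fun i j => (hM i j _).2 rfl
  refine ⟨M, fun α β m => by simp only [RootLattice.IsCoxeterLabel, ← hM α β m, hbΔ], ?_⟩
  refine CoxeterForm.IsRealization.isIrreducibleFiniteType (B := B) (v := b)
    { symm := h.symm
      pos := h.pos
      linearIndependent := b.linearIndependent
      norm := fun i => h.norm _ (hb.mem i)
      label_ne_zero := fun i j => (hM' i j).1.ne'
      nonpos := fun i j hij => ReflectionSystem.IsSimpleBasis.apply_nonpos h hb hij
      le_of_three_le := fun i j => ReflectionSystem.apply_le_of_three_le hι (hM' i j).2
      sq_of_four_le := fun i j => ReflectionSystem.le_apply_sq_of_four_le hι (hM' i j).2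
      le_of_five_le := fun i j => ReflectionSystem.apply_le_of_five_le hι (hM' i j).2
      sq_of_six_le := fun i j => ReflectionSystem.le_apply_sq_of_six_le hι (hM' i j).2
      connected := fun S hS hS' => ?_ }
  -- With no edge between `S` and its complement, all labels across are `2`; the two parts are
  -- orthogonal and `L` is reducible.
  by_contra! hc
  refine hirr (RootLattice.isReducible_of_orthogonal b hbL hS hS' fun i hi j hj => ?_)
  refine ReflectionSystem.apply_eq_zero_of_label_eq_two (hM' i j).2 ?_
  have h1 := hc i hi j hj
  have h2 := (hM' i j).1
  have h3 := M.off_diagonal i j fun e => hj (e ▸ hi)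
  omega
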